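/- **Setting.** Let $G=(V,E,w)$ be a finite simple undirected graph with $n=|V|$ and weights $w:E\to\mathbb R_{>0}$, and let $k\ge 1$. A $k$-disjoint matching is a family $\mathcal M=(M_1,\dots,M_k)$ of pairwise edge-disjoint matchings of $G$; its weight is $w(\mathcal M)=\sum_{i=1}^k\sum_{e\in M_i}w(e)$. It is $\alpha$-approximate if $w(\mathcal M)\ge\alpha\, w(\mathcal M')$ for every $k$-disjoint matching $\mathcal M'$ of $G$. The edges are presented with their weights, each exactly once, in an arbitrary order, and are read one at a time in a single pass. All choices that the algorithm below leaves open (ties, orders, free colors) may be made arbitrarily. **Algorithm** (with parameter $\varepsilon>0$). 1. *Streaming phase* (semi-streaming $b$-matching of Huang and Sellier with $b\equiv k$ and parameter $\varepsilon'=\varepsilon/2$). Keep a stack $\mathcal S$ and, for each $v\in V$, $i\in[k]$, a value $\varphi(v,i)$ (initially $0$) and a pointer $t_v(i)$ (initially $\emptyset$). When $e=(u,v)$ arrives, let $q_u,q_v$ minimize $\varphi(u,\cdot),\varphi(v,\cdot)$. If $w(e)\ge(1+\varepsilon'/2)(\varphi(u,q_u)+\varphi(v,q_v))$, push $e$ on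 $\mathcal S$, put $p_u(e)=t_u(q_u)$ and $p_v(e)=t_v(q_v)$, increase both $\varphi(u,q_u)$ and $\varphi(v,q_v)$ by $w(e)-\varphi(u,q_u)-\varphi(v,q_v)$ (old values), and set $t_u(q_u)=t_v(q_v)=e$. Otherwise discard $e$. 2. *Unwinding.* Flag all edges of $\mathcal S$ as true and put $F=\emptyset$. Pop the edges one by one; when the flag of the popped edge $e$ is true, add $e$ to $F$ and, for each endpoint $x$ of $e$, set to false the flags of $e,\,p_x(e),\,p_x(p_x(e)),\dots$ 3. *Coloring.* Let $\Delta_F$ be the maximum degree in $F$. Color the edges of $F$ with the colors $1,\dots,\Delta_F+1$ by the Misra–Gries algorithm. An uncolored edge $(u,v)$ gets a color that is free on both $u$ and $v$, if there is one. Otherwise build a maximal fan at $u$ that starts with $v$; let $z$ be its last vertex and $d$ a color free on $z$; if $d$ is not free on $u$, take a color $c$ free on $u$, exchange the colors $c,d$ on the maximal path from $u$ whose edges are alternately colored $d,c$, and cut the fan after its first vertex on which $d$ is free; finally rotate the fan and give the edge from $u$ to its last vertex the color $d$. 4. *Output.* If $\Delta_F+1=k+1$, rename the colors so that $k+1$ is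 a color class of minimum weight. Return $M_i=\{e\in F: e\text{ has color }i\}$ for $i\in[k]$. **Space.** The space in use at a given moment is the total number of bits of all variables that the algorithm keeps (values $\varphi$, pointers, stack, flags, $F$, coloring, and the local variables of the procedure being executed, including the array of sums from which a lightest color class is found), where a vertex takes $O(\log n)$ bits, a number (an edge weight or a $\varphi(v,i)$) takes $B$ bits, and a sum of weights of a color class takes $B+O(\log n)$ bits. As usual in this model, the ratio of the largest to the smallest weight is polynomial in $n$, and a number takes $B=O(\log n)$ bits. **Theorem.** Let $\varepsilon>0$ be a constant. (a) For all $n\ge0$, $k\ge1$, all $G$, $w$ and all stream orders, every run of the algorithm halts after finitely many steps, and its output is a $\frac{1}{2+\varepsilon}\left(1-\frac1{k+1}\right)$-approximate $k$-disjoint matching of $G$. (b) The algorithm uses $O(nk\log^2 n)$ bits of space: for every $r\in\mathbb N$ there is a constant $K=K(\varepsilon,r)$ such that for all $n\ge2$, $k\ge1$, all $G$, all $w$ with $w(e)\le n^r w(f)$ for all $e,f\in E$, all $B\le r\log_2 n$ and all stream orders, at every moment of every run the space in use is at most $K\,nk\log_2^2 n$ bits. (c) Numbers of $B$ bits suffice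 whenever the weights themselves are such numbers: if for some unit $s>0$ every weight is $a\cdot s$ with an integer $0\le a<2^B$, then at every moment of every run every stored number is of this form, and every stored sum of weights of a color class is $a\cdot s$ with an integer $0\le a<2^{B+\lfloor\log_2 n\rfloor+1}$ (for $n\ge1$). -/

import Mathlib

namespace KDM

/-! ### The problem -/

/-- A set of edges, no two of which share a vertex. -/
def IsMatching {n : ℕ} (M : Finset (Sym2 (Fin n))) : Prop :=
  ∀ e ∈ M, ∀ f ∈ M, e ≠ f → ∀ v, v ∈ e → v ∉ f

/-- A `k`-disjoint matching of `G`: `k` pairwise edge-disjoint matchings in `G`. -/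
def IsDisjointMatching {n k : ℕ} (G : SimpleGraph (Fin n))
    (M : Fin k → Finset (Sym2 (Fin n))) : Prop :=
  (∀ i, ∀ e ∈ M i, e ∈ G.edgeSet) ∧ (∀ i, IsMatching (M i)) ∧
    ∀ i j, i ≠ j → Disjoint (M i) (M j)

/-- The total weight of a family of edge sets. -/
noncomputable def weight {n k : ℕ} (w : Sym2 (Fin n) → ℝ)
    (M : Fin k → Finset (Sym2 (Fin n))) : ℝ :=
  ∑ i, ∑ e ∈ M i, w e

/-- `M` is an `α`-approximate `k`-disjoint matching of the weighted graph `(G, w)`. -/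
def IsApprox {n k : ℕ} (α : ℝ) (G : SimpleGraph (Fin n)) (w : Sym2 (Fin n) → ℝ)
    (M : Fin k → Finset (Sym2 (Fin n))) : Prop :=
  IsDisjointMatching G M ∧
    ∀ M' : Fin k → Finset (Sym2 (Fin n)), IsDisjointMatching G M' → α * weight w M' ≤ weight w M

/-! ### The input stream -/

/-- An edge `(u, v)` together with its weight, as it is presented by the stream. -/
structure Item (n : ℕ) where
  u : Fin n
  v : Fin n
  wt : ℝ

/-- The underlying undirected edge. -/
def Item.edge {n : ℕ} (a : Item n) : Sym2 (Fin n) := s(a.u, a.v)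

/-- The list `l` presents every edge of `G` exactly once, with its weight, in some order. -/
def IsStream {n : ℕ} (G : SimpleGraph (Fin n)) (w : Sym2 (Fin n) → ℝ) (l : List (Item n)) : Prop :=
  (l.map Item.edge).Nodup ∧ (∀ e, e ∈ l.map Item.edge ↔ e ∈ G.edgeSet) ∧
    ∀ a ∈ l, a.wt = w a.edge

/-! ### The memory of the algorithm -/

/-- The program counter together with the local variables of the procedure being executed.
* `stream`: the streaming phase;
* `unwind`: the head of the loop that pops the stack;
* `chase e x c`: the edge `e` was just taken, pointers of the endpoint `x` of `e` are being
  chased, and `c` is the current pointer (`none` is the empty pointer);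
* `coloring`: the head of the main loop of the edge coloring;
* `fan u l`: a fan at `u` is being built, with the array `l` so far;
* `path u l c d x z q`: the maximal path from `u` with colors alternating between `d` and `c` is
  being inverted; `l` is the fan, `x` the current vertex, `z` the one before it, `q` the color of
  the next edge on the path;
* `select l s`: the weights of the color classes are being summed up in the array `s`, with
  the edges in `l` still to be treated;
* `halt`: the output is ready. -/
inductive Phase (n : ℕ) where
  | stream
  | unwind
  | chase (e : Item n) (x : Fin n) (c : Option (Sym2 (Fin n)))
  | coloring
  | fan (u : Fin n) (l : List (Fin n))
  | path (u : Fin n) (l : List (Fin n)) (c d : ℕ) (x : Fin n) (z : Option (Fin n)) (q : ℕ)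
  | select (l : List (Item n)) (s : ℕ → ℝ)
  | halt

/-- All the variables of the algorithm. The pointers are edges or empty (`none`). `p`, `flag` and
`color` are dictionaries, in which `none` means that no value is stored (respectively the empty
pointer, no flag, uncolored). -/
structure Mem (n k : ℕ) where
  /-- the values `φ(v, i)` -/
  phi : Fin n → Fin k → ℝ
  /-- the pointers `t_v(i)` -/
  t : Fin n → Fin k → Option (Sym2 (Fin n))
  /-- the pointers `p_x(e)`, as `p x e` -/
  p : Fin n → Sym2 (Fin n) → Option (Sym2 (Fin n))
  /-- the stack, top first -/
  stack : List (Item n)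
  /-- the flags `a_e` -/
  flag : Sym2 (Fin n) → Option Bool
  /-- the `k`-matching `F` -/
  F : List (Item n)
  /-- the maximum degree of a vertex in `F` -/
  maxDeg : ℕ
  /-- the edge coloring, with colors `1, 2, …` -/
  color : Sym2 (Fin n) → Option ℕ
  /-- the program counter and the local variables -/
  phase : Phase n

/-- The memory before the stream starts. -/
def initMem (n k : ℕ) : Mem n k where
  phi := fun _ _ => 0
  t := fun _ _ => none
  p := fun _ _ => none
  stack := []
  flag := fun _ => none
  F := []
  maxDeg := 0
  color := fun _ => none
  phase := Phase.stream

/-! ### The streaming phase: semi-streaming `b`-matching with `b ≡ k` -/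

/-- The memory after the edge `a = (u, v)` was pushed, when `i` and `j` are the selected indices
of `u` and `v`. -/
noncomputable def Mem.push {n k : ℕ} (m : Mem n k) (a : Item n) (i j : Fin k) : Mem n k :=
  let gain := a.wt - (m.phi a.u i + m.phi a.v j)
  { m with
    stack := a :: m.stack
    p := fun x e =>
      if e = a.edge ∧ x = a.u then m.t a.u i
      else if e = a.edge ∧ x = a.v then m.t a.v j
      else m.p x e
    phi := fun x q =>
      if x = a.u ∧ q = i then m.phi a.u i + gain
      else if x = a.v ∧ q = j then m.phi a.v j + gain
      else m.phi x q
    t := fun x q =>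
      if (x = a.u ∧ q = i) ∨ (x = a.v ∧ q = j) then some a.edge else m.t x q }

/-- `Arrive ε a m m'`: the semi-streaming `b`-matching algorithm with parameter `ε` (and `b ≡ k`)
may pass from the memory `m` to `m'` when the edge `a` arrives. Ties between minimizing indices
may be broken in any way. -/
inductive Arrive {n k : ℕ} (ε : ℝ) (a : Item n) (m : Mem n k) : Mem n k → Prop
  | push (i j : Fin k) (hi : ∀ q, m.phi a.u i ≤ m.phi a.u q) (hj : ∀ q, m.phi a.v j ≤ m.phi a.v q)
      (h : (1 + ε / 2) * (m.phi a.u i + m.phi a.v j) ≤ a.wt) : Arrive ε a m (m.push a i j)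
  | skip (i j : Fin k) (hi : ∀ q, m.phi a.u i ≤ m.phi a.u q) (hj : ∀ q, m.phi a.v j ≤ m.phi a.v q)
      (h : a.wt < (1 + ε / 2) * (m.phi a.u i + m.phi a.v j)) : Arrive ε a m m

/-- The end of the stream: `F` is empty, and every edge on the stack gets the flag `true`. -/
def Mem.startUnwind {n k : ℕ} (m : Mem n k) : Mem n k :=
  { m with
    F := []
    flag := fun e => if e ∈ m.stack.map Item.edge then some true else none
    phase := Phase.unwind }

/-! ### Post-processing -/

/-- The maximum over all vertices `v` of the number of edges in `F` that `v` is incident on. -/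
def maxDegree {n : ℕ} (F : List (Item n)) : ℕ :=
  Finset.univ.sup fun v : Fin n => (F.filter fun a => decide (v ∈ a.edge)).length

/-- The color `a` is free on `v`: no edge incident on `v` has it. -/
def Free {n : ℕ} (C : Sym2 (Fin n) → Option ℕ) (v : Fin n) (a : ℕ) : Prop :=
  ∀ y, C s(v, y) ≠ some a

open Classical in
/-- The fan up to the first vertex on which `d` is free (unchanged if there is none). -/
noncomputable def shrinkFan {n : ℕ} (C : Sym2 (Fin n) → Option ℕ) (d : ℕ) :
    List (Fin n) → List (Fin n)
  | [] => []
  | x :: l => if Free C x d then [x] else x :: shrinkFan C d l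

/-- The colors of the edges from `u` to the fan are shifted by one position, and the last of these
edges becomes uncolored. -/
def rotateFan {n : ℕ} (u : Fin n) :
    (Sym2 (Fin n) → Option ℕ) → List (Fin n) → (Sym2 (Fin n) → Option ℕ)
  | C, [] => C
  | C, [z] => Function.update C s(u, z) none
  | C, x :: y :: l => rotateFan u (Function.update C s(u, x) (C s(u, y))) (y :: l)

/-- One step of the post-processing: unwinding the stack, coloring the edges of `F` with the colors
`1, …, maxDeg + 1`, and, if `k + 1` colors were available, exchanging the lightest color class with
class `k + 1`. Every choice that the algorithm leaves open may be made in any way. -/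
inductive PostStep {n k : ℕ} (m : Mem n k) : Mem n k → Prop
  /-- the popped edge has the flag `true`: it is added to `F` -/
  | popTake (a : Item n) (S : List (Item n)) (hp : m.phase = Phase.unwind) (hS : m.stack = a :: S)
      (ha : m.flag a.edge = some true) :
      PostStep m { m with stack := S, F := a :: m.F, phase := Phase.chase a a.u (some a.edge) }
  /-- the popped edge has the flag `false` -/
  | popDrop (a : Item n) (S : List (Item n)) (hp : m.phase = Phase.unwind) (hS : m.stack = a :: S)
      (ha : m.flag a.edge = some false) :
      PostStep m { m with stack := S }
  /-- one step of pointer chasing -/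
  | chaseStep (a : Item n) (x : Fin n) (c : Sym2 (Fin n)) (hp : m.phase = Phase.chase a x (some c)) :
      PostStep m { m with
        flag := Function.update m.flag c (some false)
        phase := Phase.chase a x (m.p x c) }
  /-- the chase for the first endpoint is over -/
  | chaseNext (a : Item n) (hp : m.phase = Phase.chase a a.u none) :
      PostStep m { m with phase := Phase.chase a a.v (some a.edge) }
  /-- the chase for the second endpoint is over -/
  | chaseEnd (a : Item n) (hp : m.phase = Phase.chase a a.v none) :
      PostStep m { m with phase := Phase.unwind }
  /-- the stack is empty: the coloring starts, with all edges uncolored -/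
  | startColoring (hp : m.phase = Phase.unwind) (hS : m.stack = []) :
      PostStep m { m with
        maxDeg := maxDegree m.F
        color := fun _ => none
        phase := Phase.coloring }
  /-- an uncolored edge whose endpoints have a common free color gets such a color -/
  | commonColor (u v : Fin n) (a : ℕ) (hp : m.phase = Phase.coloring)
      (he : s(u, v) ∈ m.F.map Item.edge) (hc : m.color s(u, v) = none)
      (ha : a ∈ Finset.Icc 1 (m.maxDeg + 1)) (hu : Free m.color u a) (hv : Free m.color v a) :
      PostStep m { m with color := Function.update m.color s(u, v) (some a) }
  /-- otherwise a fan is started -/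
  | startFan (u v : Fin n) (hp : m.phase = Phase.coloring)
      (he : s(u, v) ∈ m.F.map Item.edge) (hc : m.color s(u, v) = none)
      (ha : ∀ a ∈ Finset.Icc 1 (m.maxDeg + 1), ¬ (Free m.color u a ∧ Free m.color v a)) :
      PostStep m { m with phase := Phase.fan u [v] }
  /-- the fan is extended -/
  | extendFan (u : Fin n) (l : List (Fin n)) (z x : Fin n) (a : ℕ) (hp : m.phase = Phase.fan u l)
      (hz : l.getLast? = some z) (hx : x ∉ l) (hc : m.color s(u, x) = some a)
      (ha : Free m.color z a) :
      PostStep m { m with phase := Phase.fan u (l ++ [x]) }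
  /-- the fan is maximal and `d` is free on both its last vertex and `u`: the fan is rotated and
  its last edge gets the color `d` -/
  | rotate (u : Fin n) (l : List (Fin n)) (z : Fin n) (d : ℕ) (hp : m.phase = Phase.fan u l)
      (hz : l.getLast? = some z)
      (hmax : ∀ x a, x ∉ l → m.color s(u, x) = some a → ¬ Free m.color z a)
      (hd : d ∈ Finset.Icc 1 (m.maxDeg + 1)) (hdz : Free m.color z d) (hdu : Free m.color u d) :
      PostStep m { m with
        color := Function.update (rotateFan u m.color l) s(u, z) (some d)
        phase := Phase.coloring }
  /-- the fan is maximal, `d` is free on its last vertex but not on `u`, and `c` is free on `u` -/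
  | startPath (u : Fin n) (l : List (Fin n)) (z : Fin n) (c d : ℕ) (hp : m.phase = Phase.fan u l)
      (hz : l.getLast? = some z)
      (hmax : ∀ x a, x ∉ l → m.color s(u, x) = some a → ¬ Free m.color z a)
      (hc : c ∈ Finset.Icc 1 (m.maxDeg + 1)) (hcu : Free m.color u c)
      (hd : d ∈ Finset.Icc 1 (m.maxDeg + 1)) (hdz : Free m.color z d) (hdu : ¬ Free m.color u d) :
      PostStep m { m with phase := Phase.path u l c d u none d }
  /-- the next edge of the path exists: it gets the other color -/
  | pathStep (u : Fin n) (l : List (Fin n)) (c d : ℕ) (x : Fin n) (z : Option (Fin n)) (q : ℕ)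
      (y : Fin n) (hp : m.phase = Phase.path u l c d x z q) (hy : z ≠ some y)
      (hq : m.color s(x, y) = some q) :
      PostStep m { m with
        color := Function.update m.color s(x, y) (some (if q = d then c else d))
        phase := Phase.path u l c d y (some x) (if q = d then c else d) }
  /-- the path ends: the fan is shrunk and rotated, and its last edge gets the color `d` -/
  | pathEnd (u : Fin n) (l : List (Fin n)) (c d : ℕ) (x : Fin n) (z : Option (Fin n)) (q : ℕ)
      (z' : Fin n) (hp : m.phase = Phase.path u l c d x z q)
      (hmax : ∀ y, z ≠ some y → m.color s(x, y) ≠ some q)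
      (hz' : (shrinkFan m.color d l).getLast? = some z') :
      PostStep m { m with
        color := Function.update (rotateFan u m.color (shrinkFan m.color d l)) s(u, z') (some d)
        phase := Phase.coloring }
  /-- everything is colored, and at most `k` colors were available -/
  | finish (hp : m.phase = Phase.coloring) (hc : ∀ a ∈ m.F, m.color a.edge ≠ none)
      (hk : m.maxDeg + 1 ≠ k + 1) :
      PostStep m { m with phase := Phase.halt }
  /-- everything is colored, and `k + 1` colors were available -/
  | startSelect (hp : m.phase = Phase.coloring) (hc : ∀ a ∈ m.F, m.color a.edge ≠ none)
      (hk : m.maxDeg + 1 = k + 1) :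
      PostStep m { m with phase := Phase.select m.F (fun _ => 0) }
  /-- the weight of an edge is added to the weight of its color class -/
  | selectStep (a : Item n) (l : List (Item n)) (s : ℕ → ℝ) (c : ℕ)
      (hp : m.phase = Phase.select (a :: l) s) (hc : m.color a.edge = some c) :
      PostStep m { m with phase := Phase.select l (Function.update s c (s c + a.wt)) }
  /-- a lightest color class `c` exchanges its name with the class `k + 1` -/
  | selectEnd (s : ℕ → ℝ) (c : ℕ) (hp : m.phase = Phase.select [] s)
      (hc : c ∈ Finset.Icc 1 (k + 1)) (hmin : ∀ c' ∈ Finset.Icc 1 (k + 1), s c ≤ s c') :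
      PostStep m { m with
        color := fun e => (m.color e).map (Equiv.swap c (k + 1))
        phase := Phase.halt }

/-! ### The whole algorithm -/

/-- The part of the stream that has not been read, and the memory. -/
abbrev Config (n k : ℕ) := List (Item n) × Mem n k

/-- One step of the algorithm with parameter `ε`. The stream is read once, one edge at a time, by
the semi-streaming `b`-matching algorithm with parameter `ε / 2`; the post-processing depends on
the memory only. -/
inductive Step {n k : ℕ} (ε : ℝ) : Config n k → Config n k → Prop
  | read (a : Item n) (l : List (Item n)) (m m' : Mem n k) (hp : m.phase = Phase.stream)
      (h : Arrive (ε / 2) a m m') : Step ε (a :: l, m) (l, m')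
  | endOfStream (m : Mem n k) (hp : m.phase = Phase.stream) : Step ε ([], m) ([], m.startUnwind)
  | post (m m' : Mem n k) (h : PostStep m m') : Step ε ([], m) ([], m')

/-- The configurations that some run of the algorithm on the stream `l` reaches. -/
def Reaches {n k : ℕ} (ε : ℝ) (l : List (Item n)) (c : Config n k) : Prop :=
  Relation.ReflTransGen (Step ε) (l, initMem n k) c

/-- Every run on the stream `l` ends after finitely many steps, in the phase `halt`. -/
def AlwaysHalts {n : ℕ} (k : ℕ) (ε : ℝ) (l : List (Item n)) : Prop :=
  (¬ ∃ f : ℕ → Config n k, f 0 = (l, initMem n k) ∧ ∀ i, Step ε (f i) (f (i + 1))) ∧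
    ∀ c : Config n k, Reaches ε l c → (¬ ∃ c', Step ε c c') → c.2.phase = Phase.halt

/-- The output: the `i`-th matching consists of the edges of `F` with the `i`-th color, for the
colors `1, …, k`. -/
def Mem.output {n k : ℕ} (m : Mem n k) (i : Fin k) : Finset (Sym2 (Fin n)) :=
  (m.F.map Item.edge).toFinset.filter fun e => m.color e = some (i.val + 1)

/-! ### Space -/

/-- The number of keys for which a dictionary stores a value. -/
def dictSize {α β : Type} [Fintype α] (f : α → Option β) : ℕ :=
  (Finset.univ.filter fun x => (f x).isSome = true).card

/-- The number of bits for the local variables. A vertex takes `Nat.size n` bits, a number `B` bits,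
a color `Nat.size (D + 1)` bits, and a sum of numbers in the array of weights of the `D + 1` color
classes takes `B + Nat.size n` bits; an empty value is marked by one more bit. -/
def Phase.bits {n : ℕ} (B D : ℕ) : Phase n → ℕ
  | .stream => 0
  | .unwind => 0
  | .chase _ _ _ => (2 * Nat.size n + B) + Nat.size n + (1 + 2 * Nat.size n)
  | .coloring => 0
  | .fan _ l => (1 + l.length) * Nat.size n
  | .path _ l _ _ _ _ _ => (1 + l.length) * Nat.size n + Nat.size n + (1 + Nat.size n)
      + 3 * Nat.size (D + 1)
  | .select l _ => l.length * (2 * Nat.size n + B) + (D + 1) * (B + Nat.size n)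
  | .halt => 0

/-- The number of bits of memory in use, when a number (the weight of an edge, or `φ(v, i)`) takes
`B` bits. Besides the variables this counts the program counter, the input parameters, and a fixed
number of registers for evaluating expressions. -/
def Mem.bits {n k : ℕ} (B : ℕ) (m : Mem n k) : ℕ :=
  n * k * B                                                              -- phi
    + n * k * (1 + 2 * Nat.size n)                                       -- t
    + dictSize (fun xe : Fin n × Sym2 (Fin n) => m.p xe.1 xe.2) *
        (3 * Nat.size n + 2 * Nat.size n)                                -- p
    + m.stack.length * (2 * Nat.size n + B)                              -- stack
    + dictSize m.flag * (2 * Nat.size n + 1)                             -- flag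
    + m.F.length * (2 * Nat.size n + B)                                  -- F
    + Nat.size m.maxDeg                                                  -- maxDeg
    + dictSize m.color * (2 * Nat.size n + Nat.size (m.maxDeg + 1))      -- color
    + (3 + m.phase.bits B m.maxDeg)                                      -- phase
    + (Nat.size n + Nat.size k)                                          -- input parameters
    + 8 * (B + 2 * Nat.size n + Nat.size k)                              -- registers

/-- `x` is a multiple `a * s` of the unit `s`, where the natural number `a` has at most `B` bits. -/
def Fits (s : ℝ) (B : ℕ) (x : ℝ) : Prop := ∃ a : ℕ, a < 2 ^ B ∧ x = a * s

/-- Every number among the local variables fits into the space that `Phase.bits` allots to it. -/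
def Phase.NumbersFit {n : ℕ} (s : ℝ) (B : ℕ) : Phase n → Prop
  | .chase a _ _ => Fits s B a.wt
  | .select l σ => (∀ a ∈ l, Fits s B a.wt) ∧ ∀ c, Fits s (B + Nat.size n) (σ c)
  | _ => True

/-- Every number in memory fits into the space that `Mem.bits` allots to it. -/
def Mem.NumbersFit {n k : ℕ} (s : ℝ) (B : ℕ) (m : Mem n k) : Prop :=
  (∀ v i, Fits s B (m.phi v i)) ∧ (∀ a ∈ m.stack, Fits s B a.wt) ∧ (∀ a ∈ m.F, Fits s B a.wt) ∧
    m.phase.NumbersFit s B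

end KDM

namespace KDM

/-! ### Pushed edges, queues and levels -/

/-! Write δ = ε/4, so that the push threshold is 1 + δ. The pushed edges at a vertex x are
distributed over k queues (x, q). Each pushed edge joins one queue at each endpoint and has a gain
g, its weight minus the two old values φ. Thus φ(x, q) is the sum of the gains in its queue
(`level`), and summing over all queues counts every gain twice. The total gain is compared with the
optimum and with F.

Upper bound (`weight_le_sum_level`). Let M have all degrees at most k. A pushed edge weighs at most
the two levels that it creates, a discarded one at most 1 + δ times the sum of the minimum levels at
its endpoints. At a fixed x, the pushed edges of M may have reused a queue, but they always chose a
lowest one. An exchange argument (`exists_queues_push`, `load_le`) therefore charges all edges of M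
at x to distinct queues, and w(M) is at most 2(1 + δ) times the total gain.

Lower bound (`Unwound.take`). Chasing pointers from a taken edge marks everything earlier in its two
queues as false, so each queue contributes at most one edge to F and degrees in F are at most k. The
weight of a taken edge is its gain plus the gains of all its predecessors in the two queues, which
pays for every edge that it kills. Hence w(F) is at least the total gain.

Coloring. The Misra–Gries procedure colors F properly with one color more than its maximum degree.
Rotating a fan colors one more edge (`rotateFan_spec`); inverting the alternating path makes d free
on the center while an initial part of the fan remains a fan ending in a vertex where d is free
(`PathInv.finish`). A lightest among k + 1 classes has at most a fraction 1/(k + 1) of w(F), which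
yields the ratio.

Space. Each push multiplies the levels of both its queues by at least 1 + δ, while levels never
exceed the largest weight; with polynomially bounded weights a queue has length O(log n)
(`Valid.length_le`), so there are O(nk log n) pushed edges, each accounting for O(log n) bits. A new
level is a weight minus an old level, so it is again a number of B bits; a color class has at most n
edges.

All of this is carried along an arbitrary run by one invariant `Inv`, whose history of pushed edges
is a ghost variable. Every step preserves it and lowers a lexicographic measure, and outside `halt`
some step is possible. -/

/-- A pushed edge with the indices of the two queues that it joins, and its gain. -/
structure Rec (n k : ℕ) where
  a : Item n
  i : Fin k
  j : Fin k
  g : ℝ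

/-- The underlying undirected edge. -/
def Rec.edge {n k : ℕ} (h : Rec n k) : Sym2 (Fin n) := h.a.edge

/-- The pushed edge belongs to the queue `(x, q)`. -/
def Rec.InQ {n k : ℕ} (h : Rec n k) (x : Fin n) (q : Fin k) : Prop :=
  (x = h.a.u ∧ q = h.i) ∨ (x = h.a.v ∧ q = h.j)

instance {n k : ℕ} (h : Rec n k) (x : Fin n) (q : Fin k) : Decidable (h.InQ x q) := by
  unfold Rec.InQ; infer_instance

/-- The sum of the gains in the queue `(x, q)`. -/
def level {n k : ℕ} (H : List (Rec n k)) (x : Fin n) (q : Fin k) : ℝ :=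
  (H.map fun h => if h.InQ x q then h.g else 0).sum

@[simp] lemma level_nil {n k : ℕ} (x : Fin n) (q : Fin k) : level [] x q = 0 := rfl

lemma level_cons {n k : ℕ} (h : Rec n k) (H : List (Rec n k)) (x : Fin n) (q : Fin k) :
    level (h :: H) x q = (if h.InQ x q then h.g else 0) + level H x q := by
  simp [level]

/-- The streaming algorithm may push `h` when the history is `H` (latest first). -/
structure Admissible {n k : ℕ} (δ : ℝ) (h : Rec n k) (H : List (Rec n k)) : Prop where
  ne : h.a.u ≠ h.a.v
  pos : 0 < h.a.wt
  gain : h.g = h.a.wt - (level H h.a.u h.i + level H h.a.v h.j)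
  minu : ∀ q, level H h.a.u h.i ≤ level H h.a.u q
  minv : ∀ q, level H h.a.v h.j ≤ level H h.a.v q
  thr : (1 + δ) * (level H h.a.u h.i + level H h.a.v h.j) ≤ h.a.wt

/-- A possible history of pushed edges, latest first. -/
def Valid {n k : ℕ} (δ : ℝ) : List (Rec n k) → Prop
  | [] => True
  | h :: H => Admissible δ h H ∧ Valid δ H

section
variable {n k : ℕ} {δ : ℝ} {H : List (Rec n k)} {h : Rec n k}

lemma Rec.inQ_u (h : Rec n k) : h.InQ h.a.u h.i := Or.inl ⟨rfl, rfl⟩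
lemma Rec.inQ_v (h : Rec n k) : h.InQ h.a.v h.j := Or.inr ⟨rfl, rfl⟩

lemma Valid.append_right {H₁ : List (Rec n k)} (hv : Valid δ (H₁ ++ H)) : Valid δ H := by
  induction H₁ with
  | nil => exact hv
  | cons a l ih => exact ih hv.2

/-- The two claims need a joint induction: if the two old levels sum to zero, the gain is the weight
itself; otherwise the threshold makes it at least δ times their sum. -/
lemma Valid.nonneg (hδ : 0 < δ) (hv : Valid δ H) :
    (∀ h ∈ H, 0 < h.g) ∧ ∀ x q, 0 ≤ level H x q := by
  induction H with
  | nil => simp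
  | cons h H ih =>
    obtain ⟨ha, hv⟩ := hv
    obtain ⟨ih1, ih2⟩ := ih hv
    have hg : 0 < h.g := by
      rw [ha.gain]
      have h1 := ha.thr
      have h2 := ha.pos
      have h3 : 0 ≤ level H h.a.u h.i + level H h.a.v h.j := add_nonneg (ih2 _ _) (ih2 _ _)
      rcases h3.eq_or_lt with h4 | h4
      · rw [← h4]; linarith
      · nlinarith
    refine ⟨by simpa using ⟨hg, ih1⟩, fun x q => ?_⟩
    rw [level_cons]
    have := ih2 x q
    split_ifs <;> linarith

lemma Valid.gain_pos (hδ : 0 < δ) (hv : Valid δ H) (hh : h ∈ H) : 0 < h.g :=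
  (hv.nonneg hδ).1 h hh

lemma Valid.level_nonneg (hδ : 0 < δ) (hv : Valid δ H) (x : Fin n) (q : Fin k) :
    0 ≤ level H x q := (hv.nonneg hδ).2 x q

lemma Valid.ne (hv : Valid δ H) (hh : h ∈ H) : h.a.u ≠ h.a.v := by
  induction H with
  | nil => simp at hh
  | cons h' H ih =>
    rcases List.mem_cons.1 hh with rfl | hh
    · exact hv.1.ne
    · exact ih hv.2 hh

lemma Valid.wt_pos (hv : Valid δ H) (hh : h ∈ H) : 0 < h.a.wt := by
  induction H with
  | nil => simp at hh
  | cons h' H ih =>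
    rcases List.mem_cons.1 hh with rfl | hh
    · exact hv.1.pos
    · exact ih hv.2 hh

lemma level_le_cons (hδ : 0 < δ) (hv : Valid δ (h :: H)) (x : Fin n) (q : Fin k) :
    level H x q ≤ level (h :: H) x q := by
  rw [level_cons]
  have := hv.gain_pos hδ (List.mem_cons_self)
  split_ifs <;> linarith

/-- The identity behind both the weight bound and the bit bound: the new level at one endpoint and
the old level at the other add up to the weight. -/
lemma level_cons_u (ha : Admissible δ h H) :
    level (h :: H) h.a.u h.i = h.a.wt - level H h.a.v h.j := by
  rw [level_cons, if_pos h.inQ_u, ha.gain]; ring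

lemma level_cons_v (ha : Admissible δ h H) :
    level (h :: H) h.a.v h.j = h.a.wt - level H h.a.u h.i := by
  rw [level_cons, if_pos h.inQ_v, ha.gain]; ring

/-- Every pushed edge belongs to exactly two queues. -/
lemma sum_queues {M : Type*} [AddCommMonoid M] (f : Rec n k → M)
    (hne : ∀ h ∈ H, h.a.u ≠ h.a.v) :
    ∑ x : Fin n, ∑ q : Fin k, (H.map fun h => if h.InQ x q then f h else 0).sum
      = 2 • (H.map f).sum := by
  induction H with
  | nil => simp
  | cons h H ih =>
    simp only [List.map_cons, List.sum_cons, Finset.sum_add_distrib, smul_add]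
    rw [ih fun h' hh => hne h' (List.mem_cons_of_mem _ hh)]
    congr 1
    have hn := hne h List.mem_cons_self
    have h1 : ∀ x : Fin n, ∀ q : Fin k, (if h.InQ x q then f h else 0)
        = (if x = h.a.u then if q = h.i then f h else 0 else 0)
          + (if x = h.a.v then if q = h.j then f h else 0 else 0) := by
      intro x q
      unfold Rec.InQ
      by_cases hx : x = h.a.u
      · subst hx; simp [hn]
      · by_cases hx' : x = h.a.v
        · subst hx'; simp [hn.symm]
        · simp [hx, hx']
    simp_rw [h1, Finset.sum_add_distrib]
    rw [Finset.sum_eq_single h.a.u (by intro b _ hb; simp [hb]) (by simp),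
      Finset.sum_eq_single h.a.v (by intro b _ hb; simp [hb]) (by simp)]
    simp [two_nsmul]

lemma Valid.sum_level (hv : Valid δ H) :
    ∑ x : Fin n, ∑ q : Fin k, level H x q = 2 * (H.map Rec.g).sum := by
  have := sum_queues (H := H) Rec.g fun h hh => hv.ne hh
  rw [two_nsmul, ← two_mul] at this
  exact this

/-! ### The upper bound on the weight of a `k`-matching -/

/-- An edge whose weight is bounded by the levels of all pairs of queues at its endpoints. -/
def Covered (δ : ℝ) (w : Sym2 (Fin n) → ℝ) (H : List (Rec n k)) (e : Sym2 (Fin n)) : Prop :=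
  ∃ u v, u ≠ v ∧ e = s(u, v) ∧ ∀ q q', w e ≤ (1 + δ) * (level H u q + level H v q')

lemma Covered.cons (hδ : 0 < δ) {w : Sym2 (Fin n) → ℝ} {e : Sym2 (Fin n)}
    (hv : Valid δ (h :: H)) (hc : Covered δ w H e) : Covered δ w (h :: H) e := by
  obtain ⟨u, v, huv, he, hle⟩ := hc
  refine ⟨u, v, huv, he, fun q q' => (hle q q').trans ?_⟩
  have h1 := level_le_cons hδ hv u q
  have h2 := level_le_cons hδ hv v q'
  gcongr

/-- The levels at `x` that the edges in `M` reach when they are pushed. -/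
def load (M : Finset (Sym2 (Fin n))) : List (Rec n k) → Fin n → ℝ
  | [], _ => 0
  | h :: H, x => load M H x + if h.edge ∈ M then
      (if x = h.a.u then level (h :: H) h.a.u h.i else 0)
        + (if x = h.a.v then level (h :: H) h.a.v h.j else 0) else 0

/-- The number of pushed edges in `M` that are incident on `x`. -/
def pushedDegree (M : Finset (Sym2 (Fin n))) (H : List (Rec n k)) (x : Fin n) : ℕ :=
  (H.filter fun h => h.edge ∈ M ∧ x ∈ h.edge).length

/-- The hypothesis is the charging invariant at a vertex: c charges of total S are covered by
distinct queues Q, and the c - |Q| charges without a queue of their own are covered by any queue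
whatsoever, in particular a lowest one. It survives the growth of levels. -/
lemma exists_queues_mono {f f' : Fin k → ℝ} (hle : ∀ q, f q ≤ f' q) {S : ℝ} {c : ℕ}
    (hQ : ∃ Q : Finset (Fin k), Q.card ≤ c ∧
      ∀ q₀, S ≤ ∑ q ∈ Q, f q + ((c : ℝ) - Q.card) * f q₀) :
    ∃ Q : Finset (Fin k), Q.card ≤ c ∧ ∀ q₀, S ≤ ∑ q ∈ Q, f' q + ((c : ℝ) - Q.card) * f' q₀ := by
  obtain ⟨Q, hc, hS⟩ := hQ
  refine ⟨Q, hc, fun q₀ => (hS q₀).trans ?_⟩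
  have h1 : (0 : ℝ) ≤ (c : ℝ) - Q.card := sub_nonneg.2 (by exact_mod_cast hc)
  have h2 := hle q₀
  have h3 : ∑ q ∈ Q, f q ≤ ∑ q ∈ Q, f' q := Finset.sum_le_sum fun q _ => hle q
  gcongr

/-- If the chosen queue i can be taken in Q, its old level is at most every other level, so that old
charge becomes one without a queue of its own, and i pays for the new edge. If i cannot be in Q, it
is a fresh queue and is inserted. -/
lemma exists_queues_push {f f' : Fin k → ℝ} (hle : ∀ q, f q ≤ f' q) {i : Fin k}
    (hmin : ∀ q, f i ≤ f q) {S : ℝ} {c : ℕ}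
    (hQ : ∃ Q : Finset (Fin k), Q.card ≤ c ∧
      ∀ q₀, S ≤ ∑ q ∈ Q, f q + ((c : ℝ) - Q.card) * f q₀) :
    ∃ Q : Finset (Fin k), Q.card ≤ c + 1 ∧
      ∀ q₀, S + f' i ≤ ∑ q ∈ Q, f' q + (((c + 1 : ℕ) : ℝ) - Q.card) * f' q₀ := by
  by_cases hi : ∃ Q : Finset (Fin k), i ∈ Q ∧ Q.card ≤ c ∧
      ∀ q₀, S ≤ ∑ q ∈ Q, f q + ((c : ℝ) - Q.card) * f q₀
  · obtain ⟨Q, hiQ, hc, hS⟩ := hi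
    refine ⟨Q, hc.trans (Nat.le_succ _), fun q₀ => ?_⟩
    have h0 := hS q₀
    have h1 : (0 : ℝ) ≤ (c : ℝ) - Q.card := sub_nonneg.2 (by exact_mod_cast hc)
    have h2 : ((c : ℝ) - Q.card) * f q₀ ≤ ((c : ℝ) - Q.card) * f' q₀ := by
      have := hle q₀; gcongr
    have h3 : ∑ q ∈ Q.erase i, f q ≤ ∑ q ∈ Q.erase i, f' q := Finset.sum_le_sum fun q _ => hle q
    rw [← Finset.sum_erase_add _ _ hiQ] at h0 ⊢
    have h4 := (hmin q₀).trans (hle q₀)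
    push_cast
    nlinarith
  · obtain ⟨Q, hc, hS⟩ := hQ
    have hiQ : i ∉ Q := fun h => hi ⟨Q, h, hc, hS⟩
    refine ⟨insert i Q, by rw [Finset.card_insert_of_notMem hiQ]; omega, fun q₀ => ?_⟩
    rw [Finset.sum_insert hiQ, Finset.card_insert_of_notMem hiQ]
    have h0 := hS q₀
    have h1 : (0 : ℝ) ≤ (c : ℝ) - Q.card := sub_nonneg.2 (by exact_mod_cast hc)
    have h2 : ((c : ℝ) - Q.card) * f q₀ ≤ ((c : ℝ) - Q.card) * f' q₀ := by
      have := hle q₀; gcongr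
    have h3 : ∑ q ∈ Q, f q ≤ ∑ q ∈ Q, f' q := Finset.sum_le_sum fun q _ => hle q
    push_cast
    linarith

/-- Pushed edges in M at x may share a queue, so their loads cannot be charged to their own queues;
the invariant is pushed along the history instead, using that each edge entered a lowest queue. -/
lemma load_le (hδ : 0 < δ) (M : Finset (Sym2 (Fin n))) (hv : Valid δ H) (x : Fin n) :
    ∃ Q : Finset (Fin k), Q.card ≤ pushedDegree M H x ∧ ∀ q₀, load M H x ≤
      ∑ q ∈ Q, level H x q + ((pushedDegree M H x : ℝ) - Q.card) * level H x q₀ := by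
  induction H with
  | nil => exact ⟨∅, by simp, fun q₀ => by simp [load, pushedDegree]⟩
  | cons h H ih =>
    have hle : ∀ q, level H x q ≤ level (h :: H) x q := level_le_cons hδ hv x
    obtain ⟨ha, hv'⟩ := hv
    have hmem : x ∈ h.edge ↔ x = h.a.u ∨ x = h.a.v := by simp [Rec.edge, Item.edge]
    by_cases hM : h.edge ∈ M ∧ x ∈ h.edge
    · have hd : pushedDegree M (h :: H) x = pushedDegree M H x + 1 := by
        simp [pushedDegree, hM]
      rw [hd]
      rcases hmem.1 hM.2 with hx | hx
      · have := exists_queues_push hle (i := h.i) (by subst hx; exact ha.minu) (ih hv')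
        have hl : load M (h :: H) x = load M H x + level (h :: H) x h.i := by
          subst hx; simp [load, hM.1, ha.ne]
        rwa [hl]
      · have := exists_queues_push hle (i := h.j) (by subst hx; exact ha.minv) (ih hv')
        have hl : load M (h :: H) x = load M H x + level (h :: H) x h.j := by
          subst hx; simp [load, hM.1, ha.ne.symm]
        rwa [hl]
    · have hd : pushedDegree M (h :: H) x = pushedDegree M H x := by
        simp [pushedDegree, hM]
      have hl : load M (h :: H) x = load M H x := by
        by_cases hM' : h.edge ∈ M
        · have hx : ¬ (x = h.a.u ∨ x = h.a.v) := fun hx => hM ⟨hM', hmem.2 hx⟩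
          push Not at hx
          simp [load, hx.1, hx.2]
        · simp [load, hM']
      rw [hd, hl]
      exact exists_queues_mono hle (ih hv')

/-- A weight is a new level plus an old level, and the old one has not decreased in the push. No
factor 1 + δ is lost here. -/
lemma weight_le_load (hδ : 0 < δ) (M : Finset (Sym2 (Fin n))) (hv : Valid δ H) :
    (H.map fun h => if h.edge ∈ M then h.a.wt else 0).sum ≤ ∑ x, load M H x := by
  induction H with
  | nil => simp [load]
  | cons h H ih =>
    have hnn := hv.2.level_nonneg hδ
    have h0 := level_le_cons hδ hv h.a.v h.j
    obtain ⟨ha, hv'⟩ := hv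
    simp only [List.map_cons, List.sum_cons, load, Finset.sum_add_distrib]
    have h1 := ih hv'
    have h2 := level_cons_u ha
    split_ifs with hM
    · simp only [Finset.sum_add_distrib, Finset.sum_ite_eq', Finset.mem_univ, if_true]
      linarith
    · simpa using h1

lemma pushedDegree_eq (M : Finset (Sym2 (Fin n))) (hnd : (H.map Rec.edge).Nodup) (x : Fin n) :
    pushedDegree M H x = (M.filter fun e => e ∈ H.map Rec.edge ∧ x ∈ e).card := by
  have h1 : M.filter (fun e => e ∈ H.map Rec.edge ∧ x ∈ e)
      = ((H.filter fun h => h.edge ∈ M ∧ x ∈ h.edge).map Rec.edge).toFinset := by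
    ext e
    simp only [Finset.mem_filter, List.mem_map, List.mem_toFinset, List.mem_filter,
      decide_eq_true_eq]
    constructor
    · rintro ⟨he, ⟨h, hh, rfl⟩, hx⟩
      exact ⟨h, ⟨hh, he, hx⟩, rfl⟩
    · rintro ⟨h, ⟨hh, he, hx⟩, rfl⟩
      exact ⟨he, ⟨h, hh, rfl⟩, hx⟩
  rw [h1, List.toFinset_card_of_nodup, List.length_map, pushedDegree]
  exact hnd.sublist (List.filter_sublist.map _)

/-- The weight of a set of edges with degrees at most `k` is at most `1 + δ` times the sum of all
levels. -/
lemma weight_le_sum_level (hδ : 0 < δ) (hk : 1 ≤ k) {w : Sym2 (Fin n) → ℝ}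
    {M : Finset (Sym2 (Fin n))} (hv : Valid δ H) (hnd : (H.map Rec.edge).Nodup)
    (hw : ∀ h ∈ H, h.a.wt = w h.edge)
    (hM : ∀ x, (M.filter fun e => x ∈ e).card ≤ k)
    (hc : ∀ e ∈ M, e ∈ H.map Rec.edge ∨ Covered δ w H e) :
    ∑ e ∈ M, w e ≤ (1 + δ) * ∑ x : Fin n, ∑ q : Fin k, level H x q := by
  have : Nonempty (Fin k) := ⟨⟨0, hk⟩⟩
  have hex : ∀ x, ∃ q, ∀ q', level H x q ≤ level H x q' := fun x => Finite.exists_min _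
  choose qm hqm using hex
  have hnn := hv.level_nonneg hδ
  have hsplit := Finset.sum_filter_add_sum_filter_not M (fun e => e ∈ H.map Rec.edge) w
  have h1 : ∑ e ∈ M with e ∈ H.map Rec.edge, w e
      = (H.map fun h => if h.edge ∈ M then h.a.wt else 0).sum := by
    have e1 : (H.map fun h => if h.edge ∈ M then h.a.wt else 0)
        = (H.map Rec.edge).map fun e => if e ∈ M then w e else 0 := by
      rw [List.map_map]
      refine List.map_congr_left fun h hh => ?_
      simp [hw h hh]
    rw [e1, ← List.sum_toFinset _ hnd, ← Finset.sum_filter]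
    refine Finset.sum_congr ?_ fun _ _ => rfl
    ext e; simp [and_comm]
  -- Each edge that was not pushed is charged to a lowest queue at each endpoint; exchanging the
  -- sums collects the charges by vertex.
  have h2 : ∑ e ∈ M with e ∉ H.map Rec.edge, w e ≤ (1 + δ) *
      ∑ x, ((M.filter fun e => e ∉ H.map Rec.edge ∧ x ∈ e).card : ℝ) * level H x (qm x) := by
    have e2 : ∀ x, ((M.filter fun e => e ∉ H.map Rec.edge ∧ x ∈ e).card : ℝ) * level H x (qm x)
        = ∑ e ∈ M with e ∉ H.map Rec.edge, if x ∈ e then level H x (qm x) else 0 := by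
      intro x
      rw [← Finset.sum_filter, Finset.sum_const, nsmul_eq_mul, Finset.filter_filter]
    simp_rw [e2]
    rw [Finset.sum_comm, Finset.mul_sum]
    refine Finset.sum_le_sum fun e he => ?_
    rw [Finset.mem_filter] at he
    rcases hc e he.1 with h | ⟨u, v, huv, rfl, hle⟩
    · exact absurd h he.2
    · refine (hle (qm u) (qm v)).trans (le_of_eq ?_)
      congr 1
      have : ∀ x, (if x ∈ s(u, v) then level H x (qm x) else 0)
          = (if x = u then level H x (qm x) else 0)
            + (if x = v then level H x (qm x) else 0) := by
        intro x
        by_cases hx : x = u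
        · subst hx; simp [huv]
        · simp [hx]
      simp_rw [this, Finset.sum_add_distrib]
      simp
  -- At most k edges of M meet x. The charges outside `Q`, at most k - |Q| in number, are all at the
  -- minimum level, so the queues outside `Q` pay for them.
  have h3 : ∀ x, load M H x
      + ((M.filter fun e => e ∉ H.map Rec.edge ∧ x ∈ e).card : ℝ) * level H x (qm x)
      ≤ ∑ q : Fin k, level H x q := by
    intro x
    obtain ⟨Q, hQ, hS⟩ := load_le hδ M hv x
    have e0 := hS (qm x)
    have e1 : (M.filter fun e => e ∉ H.map Rec.edge ∧ x ∈ e).card + pushedDegree M H x ≤ k := by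
      rw [pushedDegree_eq M hnd]
      refine le_trans (le_of_eq ?_) (hM x)
      rw [← Finset.card_filter_add_card_filter_not (s := M.filter fun e => x ∈ e)
        (fun e => e ∈ H.map Rec.edge), Finset.filter_filter, Finset.filter_filter, add_comm]
      simp only [and_comm]
    have e2 : ((M.filter fun e => e ∉ H.map Rec.edge ∧ x ∈ e).card : ℝ) + pushedDegree M H x ≤ k := by
      exact_mod_cast e1
    have e3 : (((Qᶜ).card : ℕ) : ℝ) * level H x (qm x) ≤ ∑ q ∈ Qᶜ, level H x q := by
      rw [← nsmul_eq_mul]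
      exact Finset.card_nsmul_le_sum _ _ _ fun q _ => hqm x q
    rw [Finset.card_compl, Fintype.card_fin, Nat.cast_sub (by simpa using Q.card_le_univ)] at e3
    rw [← Finset.sum_add_sum_compl Q]
    have := hnn x (qm x)
    nlinarith
  have h4 := weight_le_load hδ M hv
  rw [← hsplit, h1]
  calc _ ≤ ∑ x, load M H x + (1 + δ) *
      ∑ x, ((M.filter fun e => e ∉ H.map Rec.edge ∧ x ∈ e).card : ℝ) * level H x (qm x) :=
        add_le_add h4 h2
    _ ≤ (1 + δ) * ∑ x, load M H x + (1 + δ) *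
      ∑ x, ((M.filter fun e => e ∉ H.map Rec.edge ∧ x ∈ e).card : ℝ) * level H x (qm x) := by
        have : 0 ≤ ∑ x, load M H x := by
          refine le_trans ?_ h4
          refine List.sum_nonneg ?_
          intro y hy
          obtain ⟨h, hh, rfl⟩ := List.mem_map.1 hy
          have hpos := (hv.wt_pos hh).le
          split_ifs <;> simp [hpos]
        nlinarith
    _ = (1 + δ) * ∑ x, (load M H x
      + ((M.filter fun e => e ∉ H.map Rec.edge ∧ x ∈ e).card : ℝ) * level H x (qm x)) := by
        rw [Finset.sum_add_distrib, mul_add]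
    _ ≤ _ := by
        have := Finset.sum_le_sum fun x (_ : x ∈ Finset.univ) => h3 x
        gcongr

/-! ### The lengths of the queues -/

/-- The number of pushed edges in the queue `(x, q)`. -/
def queueLength (H : List (Rec n k)) (x : Fin n) (q : Fin k) : ℕ :=
  (H.map fun h => if h.InQ x q then 1 else 0).sum

lemma queueLength_cons (x : Fin n) (q : Fin k) :
    queueLength (h :: H) x q = (if h.InQ x q then 1 else 0) + queueLength H x q := by
  simp [queueLength]

lemma Valid.sum_queueLength (hv : Valid δ H) :
    ∑ x : Fin n, ∑ q : Fin k, queueLength H x q = 2 * H.length := by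
  have := sum_queues (H := H) (fun _ => (1 : ℕ)) fun h hh => hv.ne hh
  simpa [two_nsmul, ← two_mul, queueLength] using this

lemma Valid.level_le (hδ : 0 < δ) (hv : Valid δ H) {W : ℝ} (hW : 0 ≤ W)
    (hle : ∀ h ∈ H, h.a.wt ≤ W) (x : Fin n) (q : Fin k) : level H x q ≤ W := by
  induction H with
  | nil => simpa
  | cons h H ih =>
    have h0 := ih hv.2 fun h' hh => hle h' (List.mem_cons_of_mem _ hh)
    have h1 := hle h List.mem_cons_self
    have hnn := hv.2.level_nonneg hδ
    by_cases hq : h.InQ x q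
    · rcases hq with ⟨rfl, rfl⟩ | ⟨rfl, rfl⟩
      · rw [level_cons_u hv.1]; linarith [hnn h.a.v h.j]
      · rw [level_cons_v hv.1]; linarith [hnn h.a.u h.i]
    · rw [level_cons, if_neg hq, zero_add]; exact h0

/-- The first edge of a queue raises its level to at least βδ/(1 + δ), and each further one
multiplies it by at least 1 + δ. With ℓ edges only ℓ - 1 such factors are available, whence the
square on the right. -/
lemma Valid.pow_le_level (hδ : 0 < δ) (hv : Valid δ H) {β : ℝ}
    (hle : ∀ h ∈ H, β ≤ h.a.wt) (x : Fin n) (q : Fin k) (hq : 1 ≤ queueLength H x q) :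
    (1 + δ) ^ queueLength H x q * (β * δ) ≤ (1 + δ) ^ 2 * level H x q := by
  induction H with
  | nil => simp [queueLength] at hq
  | cons h H ih =>
    have h1 := hle h List.mem_cons_self
    have hnn := hv.2.level_nonneg hδ
    by_cases hin : h.InQ x q
    -- Both follow from the threshold, as the new level is the weight minus the old level of the
    -- other endpoint, and that old level is at most the weight divided by 1 + δ.
    · have key : (1 + δ) * level H x q ≤ level (h :: H) x q ∧
          h.a.wt * δ ≤ (1 + δ) * level (h :: H) x q := by
        have ht := hv.1.thr
        have n1 := hnn h.a.u h.i
        have n2 := hnn h.a.v h.j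
        rcases hin with ⟨rfl, rfl⟩ | ⟨rfl, rfl⟩
        · rw [level_cons_u hv.1]
          constructor <;> nlinarith
        · rw [level_cons_v hv.1]
          constructor <;> nlinarith
      rw [queueLength_cons, if_pos hin]
      rcases Nat.eq_zero_or_pos (queueLength H x q) with h0 | h0
      · rw [h0]
        have : β * δ ≤ (1 + δ) * level (h :: H) x q := by nlinarith
        simp only [add_zero, pow_one]
        nlinarith
      · have := ih hv.2 (fun h' hh => hle h' (List.mem_cons_of_mem _ hh)) h0
        have h2 : (1 + δ) * ((1 + δ) ^ queueLength H x q * (β * δ))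
            ≤ (1 + δ) * ((1 + δ) ^ 2 * level H x q) := by gcongr
        have h3 : (1 + δ) ^ 2 * ((1 + δ) * level H x q)
            ≤ (1 + δ) ^ 2 * level (h :: H) x q := by gcongr; exact key.1
        rw [pow_add, pow_one]
        linarith
    · rw [queueLength_cons, if_neg hin, zero_add] at hq ⊢
      rw [level_cons, if_neg hin, zero_add]
      exact ih hv.2 (fun h' hh => hle h' (List.mem_cons_of_mem _ hh)) hq

/-- The stack is short if the ratio of the weights is polynomial. -/
lemma Valid.length_le (hδ : 0 < δ) (hv : Valid δ H) (hn : 2 ≤ n) (r : ℕ)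
    (hle : ∀ h ∈ H, ∀ h' ∈ H, h.a.wt ≤ (n : ℝ) ^ r * h'.a.wt) :
    (H.length : ℝ) ≤ n * k * (((r : ℝ) * Real.log 2 + |Real.log ((1 + δ) ^ 2 / δ)|)
      / Real.log (1 + δ) * Real.logb 2 n) := by
  set L := ((r : ℝ) * Real.log 2 + |Real.log ((1 + δ) ^ 2 / δ)|) / Real.log (1 + δ)
      * Real.logb 2 n with hL
  have hlog : 0 < Real.log (1 + δ) := Real.log_pos (by linarith)
  have hlog2 : 0 < Real.log 2 := Real.log_pos (by norm_num)
  have hn' : (2 : ℝ) ≤ n := by exact_mod_cast hn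
  -- Since log₂ n is at least 1, additive constants can be absorbed into multiples of it.
  have hΛ : 1 ≤ Real.logb 2 n := by
    rw [Real.le_logb_iff_rpow_le (by norm_num) (by linarith)]; simpa
  have hL0 : 0 ≤ L := by positivity
  have hq : ∀ x q, (queueLength H x q : ℝ) ≤ L := by
    intro x q
    rcases Nat.eq_zero_or_pos (queueLength H x q) with h0 | h0
    · rw [h0]; simpa
    · have hne : H ≠ [] := by rintro rfl; simp [queueLength] at h0
      obtain ⟨h₀, hh₀, hmin⟩ : ∃ h₀ ∈ H, ∀ h ∈ H, h₀.a.wt ≤ h.a.wt := by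
        classical
        have hne' : (H.map fun h => h.a.wt).toFinset.Nonempty := by simpa using hne
        obtain ⟨y, hy, hy'⟩ := Finset.exists_min_image _ id hne'
        simp only [List.mem_toFinset, List.mem_map] at hy
        obtain ⟨h₀, hh₀, rfl⟩ := hy
        exact ⟨h₀, hh₀, fun h hh => hy' _ (by simpa using ⟨h, hh, rfl⟩)⟩
      have hpos := hv.wt_pos hh₀
      have e1 := hv.pow_le_level hδ hmin x q h0
      have e2 := hv.level_le hδ (W := (n : ℝ) ^ r * h₀.a.wt) (by positivity)
        (fun h hh => hle h hh h₀ hh₀) x q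
      have e3 : (1 + δ) ^ queueLength H x q ≤ (n : ℝ) ^ r * ((1 + δ) ^ 2 / δ) := by
        have : (1 + δ) ^ queueLength H x q * (h₀.a.wt * δ)
            ≤ ((n : ℝ) ^ r * ((1 + δ) ^ 2 / δ)) * (h₀.a.wt * δ) := by
          calc _ ≤ (1 + δ) ^ 2 * level H x q := e1
            _ ≤ (1 + δ) ^ 2 * ((n : ℝ) ^ r * h₀.a.wt) := by gcongr
            _ = _ := by field_simp
        exact le_of_mul_le_mul_right this (by positivity)
      have e4 := Real.log_le_log (by positivity) e3
      rw [Real.log_pow, Real.log_mul (by positivity) (by positivity), Real.log_pow] at e4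
      have e5 : Real.log n = Real.log 2 * Real.logb 2 n := by
        rw [Real.logb]; field_simp
      rw [e5] at e4
      rw [hL, div_mul_eq_mul_div, le_div_iff₀ hlog]
      have e6 := le_abs_self (Real.log ((1 + δ) ^ 2 / δ))
      have e7 := abs_nonneg (Real.log ((1 + δ) ^ 2 / δ))
      nlinarith
  have h1 : (2 : ℝ) * H.length = ∑ x : Fin n, ∑ q : Fin k, (queueLength H x q : ℝ) := by
    exact_mod_cast hv.sum_queueLength.symm
  have h2 : ∑ x : Fin n, ∑ q : Fin k, (queueLength H x q : ℝ) ≤ ∑ x : Fin n, ∑ q : Fin k, L :=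
    Finset.sum_le_sum fun x _ => Finset.sum_le_sum fun q _ => hq x q
  simp only [Finset.sum_const, Finset.card_univ, Fintype.card_fin, nsmul_eq_mul] at h2
  have h3 : (0 : ℝ) ≤ n * (k * L) := by positivity
  nlinarith

/-! ### The levels are numbers of `B` bits -/

lemma Fits.zero (s : ℝ) (B : ℕ) : Fits s B 0 := ⟨0, by positivity, by simp⟩

lemma Fits.sub {s x y : ℝ} {B : ℕ} (hs : 0 < s) (hx : Fits s B x) (hy : Fits s B y) (h : y ≤ x) :
    Fits s B (x - y) := by
  obtain ⟨a, ha, rfl⟩ := hx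
  obtain ⟨b, hb, rfl⟩ := hy
  have hab : b ≤ a := by exact_mod_cast le_of_mul_le_mul_right h hs
  exact ⟨a - b, by omega, by rw [Nat.cast_sub hab]; ring⟩

/-- A changed level is a weight minus a smaller level: again a multiple of the unit, and not larger
than the weight. No rounding and no additional bits occur. -/
lemma Valid.fits_level (hδ : 0 < δ) {s : ℝ} (hs : 0 < s) {B : ℕ} (hv : Valid δ H)
    (hf : ∀ h ∈ H, Fits s B h.a.wt) (x : Fin n) (q : Fin k) : Fits s B (level H x q) := by
  induction H generalizing x q with
  | nil => exact Fits.zero s B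
  | cons h H ih =>
    have ih' := ih hv.2 fun h' hh => hf h' (List.mem_cons_of_mem _ hh)
    have hw := hf h List.mem_cons_self
    have hnn := hv.2.level_nonneg hδ
    have ht := hv.1.thr
    have n1 := hnn h.a.u h.i
    have n2 := hnn h.a.v h.j
    by_cases hq : h.InQ x q
    · rcases hq with ⟨rfl, rfl⟩ | ⟨rfl, rfl⟩
      · rw [level_cons_u hv.1]; exact hw.sub hs (ih' _ _) (by nlinarith)
      · rw [level_cons_v hv.1]; exact hw.sub hs (ih' _ _) (by nlinarith)
    · rw [level_cons, if_neg hq, zero_add]; exact ih' _ _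

end

/-! ### Pointers -/

/-- The queue `(x, q)`, latest first. -/
def queue {n k : ℕ} (H : List (Rec n k)) (x : Fin n) (q : Fin k) : List (Rec n k) :=
  H.filter fun h => h.InQ x q

/-- The pointer to the first element of a list. -/
def top {n k : ℕ} (R : List (Rec n k)) : Option (Sym2 (Fin n)) := R.head?.map Rec.edge

/-- The pointers `p` link the elements of every queue. -/
def PtrOK {n k : ℕ} (p : Fin n → Sym2 (Fin n) → Option (Sym2 (Fin n))) : List (Rec n k) → Prop
  | [] => True
  | h :: H => p h.a.u h.edge = top (queue H h.a.u h.i) ∧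
      p h.a.v h.edge = top (queue H h.a.v h.j) ∧ PtrOK p H

section
variable {n k : ℕ} {δ : ℝ} {H H₁ H₂ : List (Rec n k)} {h : Rec n k}
  {p : Fin n → Sym2 (Fin n) → Option (Sym2 (Fin n))}

lemma queue_cons (x : Fin n) (q : Fin k) :
    queue (h :: H) x q = if h.InQ x q then h :: queue H x q else queue H x q := by
  simp [queue, List.filter_cons]

lemma mem_queue {x : Fin n} {q : Fin k} : h ∈ queue H x q ↔ h ∈ H ∧ h.InQ x q := by
  simp [queue]

lemma PtrOK.congr {p' : Fin n → Sym2 (Fin n) → Option (Sym2 (Fin n))} (hp : PtrOK p H)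
    (he : ∀ h ∈ H, ∀ x, p' x h.edge = p x h.edge) : PtrOK p' H := by
  induction H with
  | nil => trivial
  | cons h H ih =>
    have e := he h List.mem_cons_self
    refine ⟨?_, ?_, ih hp.2.2 fun h' hh => he h' (List.mem_cons_of_mem _ hh)⟩
    · rw [e]; exact hp.1
    · rw [e]; exact hp.2.1

lemma PtrOK.append_right (hp : PtrOK p (H₁ ++ H)) : PtrOK p H := by
  induction H₁ with
  | nil => exact hp
  | cons a l ih => exact ih hp.2.2

/-- Chasing one pointer removes the first element from a suffix of a queue. This turns the pointer
walk into a recursion on lists. -/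
lemma PtrOK.next (hp : PtrOK p H) {x : Fin n} {q : Fin k} {r : Rec n k} {R : List (Rec n k)}
    (hR : (r :: R) <:+ queue H x q) : p x r.edge = top R := by
  induction H with
  | nil => simp [queue] at hR
  | cons h H ih =>
    rw [queue_cons] at hR
    split_ifs at hR with hin
    · rcases List.suffix_cons_iff.1 hR with he | hs
      · obtain ⟨rfl, rfl⟩ := List.cons.inj he
        rcases hin with ⟨rfl, rfl⟩ | ⟨rfl, rfl⟩
        · exact hp.1
        · exact hp.2.1
      · exact ih hp.2.2 hs
    · exact ih hp.2.2 hR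

/-! ### Unwinding -/

/-- The state of the unwinding when `H₁` has been popped, `H₂` is still on the stack and `Fr` was
taken. -/
structure Unwound (H₁ H₂ Fr : List (Rec n k)) (flag : Sym2 (Fin n) → Option Bool) : Prop where
  flagged : ∀ h ∈ H₂, flag h.edge = some true ∨ flag h.edge = some false
  sub : ∀ f ∈ Fr, f ∈ H₁
  free : ∀ h ∈ H₂, flag h.edge = some true → ∀ f ∈ Fr, ∀ x q, f.InQ x q → ¬ h.InQ x q
  pair : Fr.Pairwise fun f f' => ∀ x q, f.InQ x q → ¬ f'.InQ x q
  -- The accounting of the lower bound: the taken edges have already paid for the popped edges and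
  -- for those on the stack whose flag is false.
  wt : (H₁.map Rec.g).sum + (H₂.map fun h => if flag h.edge = some false then h.g else 0).sum
    ≤ (Fr.map fun f => f.a.wt).sum

/-- The flags after some of the pointers at the endpoints of `f` were chased. -/
structure Chased (f : Rec n k) (H₂ : List (Rec n k)) (flag₀ flag : Sym2 (Fin n) → Option Bool) :
    Prop where
  flagged : ∀ h ∈ H₂, flag h.edge = some true ∨ flag h.edge = some false
  anti : ∀ h ∈ H₂, flag h.edge = some true → flag₀ h.edge = some true
  -- An edge that was newly killed is a predecessor of `f` in one of its two queues, so `f` can pay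
  -- for it.
  cause : ∀ h ∈ H₂, flag h.edge = some false →
    flag₀ h.edge = some false ∨ h.InQ f.a.u f.i ∨ h.InQ f.a.v f.j

lemma Unwound.start {flag : Sym2 (Fin n) → Option Bool}
    (hf : ∀ h ∈ H, flag h.edge = some true) : Unwound [] H [] flag where
  flagged := fun h hh => Or.inl (hf h hh)
  sub := by simp
  free := by simp
  pair := List.Pairwise.nil
  wt := by
    have : (H.map fun h => if flag h.edge = some false then h.g else 0) = H.map fun _ => 0 :=
      List.map_congr_left fun h hh => by simp [hf h hh]
    simp [this]

lemma Unwound.drop {Fr : List (Rec n k)} {flag : Sym2 (Fin n) → Option Bool}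
    (hU : Unwound H₁ (h :: H₂) Fr flag) (hh : flag h.edge = some false) :
    Unwound (H₁ ++ [h]) H₂ Fr flag where
  flagged := fun h' hh' => hU.flagged h' (List.mem_cons_of_mem _ hh')
  sub := fun f hf => List.mem_append_left _ (hU.sub f hf)
  free := fun h' hh' => hU.free h' (List.mem_cons_of_mem _ hh')
  pair := hU.pair
  wt := by
    have := hU.wt
    simp only [List.map_cons, List.sum_cons, hh, if_true] at this
    simp only [List.map_append, List.sum_append, List.map_cons, List.map_nil, List.sum_cons,
      List.sum_nil]
    linarith

lemma Unwound.chased {Fr : List (Rec n k)} {flag : Sym2 (Fin n) → Option Bool}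
    (hU : Unwound H₁ (h :: H₂) Fr flag) : Chased h H₂ flag flag where
  flagged := fun h' hh' => hU.flagged h' (List.mem_cons_of_mem _ hh')
  anti := fun _ _ => id
  cause := fun _ _ => Or.inl

lemma eq_of_edge_eq (hnd : (H.map Rec.edge).Nodup) {h h' : Rec n k} (hh : h ∈ H) (hh' : h' ∈ H)
    (he : h.edge = h'.edge) : h = h' :=
  List.inj_on_of_nodup_map hnd hh hh' he

lemma Chased.step {f r : Rec n k} {flag₀ flag : Sym2 (Fin n) → Option Bool}
    (hC : Chased f H₂ flag₀ flag) (hnd : ((f :: H₂).map Rec.edge).Nodup) (hr : r ∈ f :: H₂)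
    (hq : r.InQ f.a.u f.i ∨ r.InQ f.a.v f.j) :
    Chased f H₂ flag₀ (Function.update flag r.edge (some false)) := by
  have key : ∀ h ∈ H₂, h = r ∨ h.edge ≠ r.edge := fun h hh => by
    by_cases he : h.edge = r.edge
    · exact Or.inl (eq_of_edge_eq hnd (List.mem_cons_of_mem _ hh) hr he)
    · exact Or.inr he
  constructor
  · intro h hh
    rcases key h hh with rfl | hne
    · simp
    · simpa [hne] using hC.flagged h hh
  · intro h hh
    rcases key h hh with rfl | hne
    · simp
    · simpa [hne] using hC.anti h hh
  · intro h hh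
    rcases key h hh with rfl | hne
    · exact fun _ => Or.inr hq
    · simpa [hne] using hC.cause h hh

/-- The weight of `f` is its gain plus the two levels just before it was pushed, that is, the gains
of all its predecessors in its two queues. This covers every flag that the two chases set to false.
The hypotheses `hu` and `hw` say that the chases reached all of them. -/
lemma Unwound.take {f : Rec n k} {Fr : List (Rec n k)} {flag₀ flag : Sym2 (Fin n) → Option Bool}
    (hδ : 0 < δ) (hv : Valid δ (f :: H₂))
    (hU : Unwound H₁ (f :: H₂) Fr flag₀) (hf : flag₀ f.edge = some true)
    (hC : Chased f H₂ flag₀ flag)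
    (hu : ∀ h ∈ H₂, flag h.edge = some true → ¬ h.InQ f.a.u f.i)
    (hw : ∀ h ∈ H₂, flag h.edge = some true → ¬ h.InQ f.a.v f.j) :
    Unwound (H₁ ++ [f]) H₂ (f :: Fr) flag where
  flagged := hC.flagged
  sub := by
    intro f' hf'
    rcases List.mem_cons.1 hf' with rfl | hf'
    · simp
    · exact List.mem_append_left _ (hU.sub f' hf')
  free := by
    intro h hh ht f' hf' x q
    rcases List.mem_cons.1 hf' with rfl | hf'
    · rintro (⟨rfl, rfl⟩ | ⟨rfl, rfl⟩)
      · exact hu h hh ht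
      · exact hw h hh ht
    · exact hU.free h (List.mem_cons_of_mem _ hh) (hC.anti h hh ht) f' hf' x q
  pair := List.pairwise_cons.2 ⟨fun f' hf' x q h1 h2 =>
    hU.free f List.mem_cons_self hf f' hf' x q h2 h1, hU.pair⟩
  wt := by
    have h0 := hU.wt
    -- Termwise comparison: a false flag is either old or belongs to a predecessor in one of the two
    -- queues. An edge counted more than once only helps, since gains are positive.
    have h1 : (H₂.map fun h => if flag h.edge = some false then h.g else 0).sum
        ≤ (H₂.map fun h => if flag₀ h.edge = some false then h.g else 0).sum
          + (level H₂ f.a.u f.i + level H₂ f.a.v f.j) := by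
      unfold level
      rw [← List.sum_map_add, ← List.sum_map_add]
      refine List.sum_le_sum fun h hh => ?_
      have hg := hv.2.gain_pos hδ hh
      by_cases hfl : flag h.edge = some false
      · rw [if_pos hfl]
        rcases hC.cause h hh hfl with hc | hc | hc
        · rw [if_pos hc]; split_ifs <;> linarith
        · rw [if_pos hc]; split_ifs <;> linarith
        · rw [if_pos hc]; split_ifs <;> linarith
      · rw [if_neg hfl]; split_ifs <;> linarith
    have h2 := hv.1.gain
    simp only [List.map_cons, List.sum_cons, hf] at h0
    simp only [List.map_append, List.sum_append, List.map_cons, List.map_nil, List.sum_cons,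
      List.sum_nil]
    simp at h0
    linarith

/-! ### Degrees -/

/-- Edges at x from pairwise disjoint queues occupy different indices among the k queues of x. -/
lemma degree_le_of_pairwise {Fr : List (Rec n k)}
    (hp : Fr.Pairwise fun f f' => ∀ x q, f.InQ x q → ¬ f'.InQ x q) (x : Fin n) :
    (Fr.filter fun f => x ∈ f.edge).length ≤ k := by
  have hp' := hp.sublist (List.filter_sublist (p := fun f => decide (x ∈ f.edge)))
  set L := Fr.filter fun f => decide (x ∈ f.edge) with hL
  have hmem : ∀ f ∈ L, f.InQ x (if x = f.a.u then f.i else f.j) := by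
    intro f hf
    have hx : x ∈ f.edge := by simpa using (List.mem_filter.1 hf).2
    by_cases h : x = f.a.u
    · rw [if_pos h]; exact Or.inl ⟨h, rfl⟩
    · have h' : x = f.a.v := by
        have : x = f.a.u ∨ x = f.a.v := by simpa [Rec.edge, Item.edge] using hx
        tauto
      rw [if_neg h]; exact Or.inr ⟨h', rfl⟩
  have hnd : (L.map fun f => if x = f.a.u then f.i else f.j).Nodup := by
    rw [List.Nodup, List.pairwise_map]
    refine hp'.imp_of_mem fun {f f'} hf hf' hff heq => ?_
    exact hff x _ (hmem f hf) (by rw [heq]; exact hmem f' hf')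
  simpa using hnd.length_le_card

lemma degree_lt_of_nodup {L : List (Sym2 (Fin n))} (hnd : L.Nodup) (hd : ∀ e ∈ L, ¬ e.IsDiag)
    (x : Fin n) : (L.filter fun e => x ∈ e).length < n := by
  have h1 : (L.filter fun e => x ∈ e).toFinset ⊆ (Finset.univ.erase x).image fun y => s(x, y) := by
    intro e he
    simp only [List.mem_toFinset, List.mem_filter, decide_eq_true_eq] at he
    obtain ⟨y, rfl⟩ := Sym2.mem_iff_exists.1 he.2
    have : x ≠ y := by simpa using hd _ he.1
    simpa using ⟨y, this.symm, Or.inl rfl⟩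
  have h2 := Finset.card_le_card h1
  rw [List.toFinset_card_of_nodup (hnd.filter _)] at h2
  have h3 := h2.trans Finset.card_image_le
  rw [Finset.card_erase_of_mem (Finset.mem_univ _), Finset.card_univ, Fintype.card_fin] at h3
  have := x.pos
  omega

end

/-! ### Partial edge colorings -/

/-- A proper coloring of some of the edges in `E` with the colors `1, …, D + 1`. -/
structure Proper {n : ℕ} (E : List (Sym2 (Fin n))) (D : ℕ) (C : Sym2 (Fin n) → Option ℕ) :
    Prop where
  supp : ∀ e, C e ≠ none → e ∈ E
  col : ∀ e a, C e = some a → a ∈ Finset.Icc 1 (D + 1)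
  inj : ∀ v y y' a, C s(v, y) = some a → C s(v, y') = some a → y = y'

/-- A fan at `u`: the first edge is uncolored, and the color of every other edge is free on the
preceding vertex. -/
structure IsFan {n : ℕ} (E : List (Sym2 (Fin n))) (C : Sym2 (Fin n) → Option ℕ) (u : Fin n)
    (l : List (Fin n)) : Prop where
  head : ∃ v l', l = v :: l' ∧ C s(u, v) = none
  mem : ∀ x ∈ l, s(u, x) ∈ E
  nodup : l.Nodup
  chain : l.IsChain fun x y => ∃ a, C s(u, y) = some a ∧ Free C x a

/-- The number of uncolored edges. -/
def uncolored {n : ℕ} (E : List (Sym2 (Fin n))) (C : Sym2 (Fin n) → Option ℕ) : ℕ :=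
  (E.toFinset.filter fun e => C e = none).card

section
variable {n D : ℕ} {E : List (Sym2 (Fin n))} {C : Sym2 (Fin n) → Option ℕ} {u : Fin n}
  {l : List (Fin n)}

lemma uncolored_lt {C' : Sym2 (Fin n) → Option ℕ} (h : ∀ e, C' e = none → C e = none)
    {e : Sym2 (Fin n)} (he : e ∈ E) (h1 : C e = none) (h2 : C' e ≠ none) :
    uncolored E C' < uncolored E C := by
  refine Finset.card_lt_card (Finset.ssubset_iff_of_subset ?_ |>.2 ⟨e, ?_, ?_⟩)
  · intro e he
    simp only [Finset.mem_filter] at he ⊢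
    exact ⟨he.1, h e he.2⟩
  · simp [he, h1]
  · simp [h2]

lemma Proper.empty : Proper E D fun _ => none :=
  ⟨by simp, by simp, by simp⟩

lemma Proper.update (hC : Proper E D C) {v : Fin n} {a : ℕ} (he : s(u, v) ∈ E)
    (ha : a ∈ Finset.Icc 1 (D + 1)) (hu : Free C u a) (hv : Free C v a) :
    Proper E D (Function.update C s(u, v) (some a)) where
  supp := by
    intro e h
    by_cases h' : e = s(u, v)
    · exact h' ▸ he
    · rw [Function.update_of_ne h'] at h; exact hC.supp e h
  col := by
    intro e b h
    by_cases h' : e = s(u, v)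
    · subst h'; simp only [Function.update_self, Option.some.injEq] at h; exact h ▸ ha
    · rw [Function.update_of_ne h'] at h; exact hC.col e b h
  inj := by
    have key : ∀ w y y' b, s(w, y) = s(u, v) → s(w, y') ≠ s(u, v) →
        Function.update C s(u, v) (some a) s(w, y) = some b →
        Function.update C s(u, v) (some a) s(w, y') = some b → False := by
      intro w y y' b h h' h1 h2
      rw [h, Function.update_self] at h1
      rw [Function.update_of_ne h'] at h2
      obtain rfl : a = b := by simpa using h1
      have hw : w = u ∨ w = v := by
        have : w ∈ s(u, v) := h ▸ Sym2.mem_mk_left w y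
        simpa using this
      rcases hw with rfl | rfl
      · exact hu _ h2
      · exact hv _ h2
    intro w y y' b h1 h2
    by_cases h : s(w, y) = s(u, v) <;> by_cases h' : s(w, y') = s(u, v)
    · have := h.trans h'.symm
      exact Sym2.congr_right.1 this
    · exact (key w y y' b h h' h1 h2).elim
    · exact (key w y' y b h' h h2 h1).elim
    · rw [Function.update_of_ne h] at h1
      rw [Function.update_of_ne h'] at h2
      exact hC.inj w y y' b h1 h2

lemma Proper.erase (hC : Proper E D C) (e : Sym2 (Fin n)) :
    Proper E D (Function.update C e none) := by
  have key : ∀ e' a, Function.update C e none e' = some a → C e' = some a := by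
    intro e' a h
    by_cases h' : e' = e
    · subst h'; simp at h
    · rwa [Function.update_of_ne h'] at h
  refine ⟨fun e' h => ?_, fun e' a h => hC.col e' a (key e' a h), fun v y y' a h h' =>
    hC.inj v y y' a (key _ a h) (key _ a h')⟩
  obtain ⟨a, ha⟩ := Option.ne_none_iff_exists'.1 h
  exact hC.supp e' (by rw [key e' a ha]; simp)

/-- Every vertex has a free color. -/
lemma Proper.exists_free (hC : Proper E D C) {x : Fin n}
    (hd : (E.filter fun e => x ∈ e).length ≤ D) : ∃ a ∈ Finset.Icc 1 (D + 1), Free C x a := by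
  by_contra! hcon
  have h1 : Finset.Icc 1 (D + 1)
      ⊆ (E.filter fun e => x ∈ e).toFinset.image fun e => (C e).getD 0 := by
    intro a ha
    have := hcon a ha
    simp only [Free, not_forall, not_not] at this
    obtain ⟨y, hy⟩ := this
    have hE := hC.supp s(x, y) (by rw [hy]; simp)
    simp only [Finset.mem_image, List.mem_toFinset, List.mem_filter]
    exact ⟨s(x, y), by simpa using hE, by simp [hy]⟩
  have h2 := (Finset.card_le_card h1).trans (Finset.card_image_le.trans (List.toFinset_card_le _))
  simp at h2
  omega

/-! ### Fans -/

lemma IsFan.prefix {l₁ : List (Fin n)} (hl : IsFan E C u l) (hp : l₁ <+: l) (hne : l₁ ≠ []) :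
    IsFan E C u l₁ where
  head := by
    obtain ⟨v, l', rfl, hv⟩ := hl.head
    obtain ⟨v₁, l₁, rfl⟩ := List.exists_cons_of_ne_nil hne
    obtain ⟨rfl, -⟩ := List.cons_prefix_cons.1 hp
    exact ⟨v₁, l₁, rfl, hv⟩
  mem := fun x hx => hl.mem x (hp.subset hx)
  nodup := hl.nodup.sublist hp.sublist
  chain := hl.chain.prefix hp

lemma IsFan.append (hC : Proper E D C) (hl : IsFan E C u l) {z x : Fin n} {a : ℕ}
    (hz : l.getLast? = some z)
    (hx : x ∉ l) (hc : C s(u, x) = some a) (ha : Free C z a) : IsFan E C u (l ++ [x]) where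
  head := by
    obtain ⟨v, l', rfl, hv⟩ := hl.head
    exact ⟨v, l' ++ [x], rfl, hv⟩
  mem := by
    intro y hy
    rcases List.mem_append.1 hy with hy | hy
    · exact hl.mem y hy
    · obtain rfl := List.mem_singleton.1 hy
      exact hC.supp _ (by simp [hc])
  nodup := List.nodup_append.2 ⟨hl.nodup, by simp, by rintro y hy z hz rfl; simp_all⟩
  chain := by
    refine List.isChain_append.2 ⟨hl.chain, by simp, ?_⟩
    intro y hy y' hy'
    simp only [List.head?_cons, Option.mem_def, Option.some.injEq] at hy'
    rw [hz] at hy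
    simp only [Option.mem_def, Option.some.injEq] at hy
    subst hy hy'
    exact ⟨a, hc, ha⟩

lemma shrinkFan_prefix (C : Sym2 (Fin n) → Option ℕ) (d : ℕ) (l : List (Fin n)) :
    shrinkFan C d l <+: l := by
  induction l with
  | nil => simp [shrinkFan]
  | cons x l ih =>
    rw [shrinkFan]
    split_ifs
    · exact ⟨l, rfl⟩
    · exact List.cons_prefix_cons.2 ⟨rfl, ih⟩

lemma shrinkFan_ne_nil (C : Sym2 (Fin n) → Option ℕ) (d : ℕ) (hl : l ≠ []) :
    shrinkFan C d l ≠ [] := by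
  cases l with
  | nil => exact absurd rfl hl
  | cons x l => rw [shrinkFan]; split_ifs <;> simp

lemma free_of_getLast?_shrinkFan {d : ℕ} (hl : ∃ x ∈ l, Free C x d) {z : Fin n}
    (hz : (shrinkFan C d l).getLast? = some z) : Free C z d := by
  induction l with
  | nil => simp at hl
  | cons x l ih =>
    rw [shrinkFan] at hz
    split_ifs at hz with h
    · simp only [List.getLast?_singleton, Option.some.injEq] at hz; exact hz ▸ h
    · have hl' : ∃ x ∈ l, Free C x d := by
        obtain ⟨y, hy, hf⟩ := hl
        rcases List.mem_cons.1 hy with rfl | hy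
        · exact absurd hf h
        · exact ⟨y, hy, hf⟩
      have hne : shrinkFan C d l ≠ [] := shrinkFan_ne_nil C d (by rintro rfl; simp at hl')
      refine ih hl' ?_
      obtain ⟨y, l', hy⟩ := List.exists_cons_of_ne_nil hne
      rw [hy] at hz ⊢
      rwa [List.getLast?_cons_cons] at hz

/-- Once d is free on some vertex of the fan, what follows that vertex is irrelevant; the fan
property need only be known up to there. -/
lemma shrinkFan_append {d : ℕ} {p : Fin n} (hp : Free C p d) (A B : List (Fin n)) :
    shrinkFan C d (A ++ p :: B) = shrinkFan C d (A ++ [p]) := by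
  induction A with
  | nil => simp [shrinkFan, hp]
  | cons x A ih => simp only [List.cons_append, shrinkFan, ih]

/-- The rotation overwrites the color of its first edge anyway. So that edge may be uncolored
beforehand, which keeps all intermediate colorings proper. -/
lemma rotateFan_update (y : Fin n) (o : Option ℕ) (l : List (Fin n)) :
    rotateFan u (Function.update C s(u, y) o) (y :: l) = rotateFan u C (y :: l) := by
  cases l with
  | nil => simp [rotateFan]
  | cons x l =>
    simp only [rotateFan, Function.update_idem]
    by_cases h : s(u, x) = s(u, y)
    · obtain rfl := Sym2.congr_right.1 h
      have key : ∀ (l : List (Fin n)) (o₁ o₂ : Option ℕ),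
          rotateFan u (Function.update C s(u, x) o₁) (x :: l)
            = rotateFan u (Function.update C s(u, x) o₂) (x :: l) := by
        intro l
        induction l with
        | nil => simp [rotateFan]
        | cons y l ih =>
          intro o₁ o₂
          simp only [rotateFan, Function.update_idem]
          by_cases h' : s(u, y) = s(u, x)
          · obtain rfl := Sym2.congr_right.1 h'
            exact ih _ _
          · rw [Function.update_of_ne h', Function.update_of_ne h']
      exact key l _ _
    · rw [Function.update_of_ne h]

/-- Induction on the fan, one shift at a time: the color of the second edge moves to the first, on
whose outer vertex it is free by the fan property, and the remaining list is a fan for the new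
coloring. The claim about the head shows progress, and in the induction it shows that the edge
uncolored by the shift regains a color. -/
lemma rotateFan_spec {z : Fin n} {d : ℕ} (hC : Proper E D C) (hl : IsFan E C u l)
    (hz : l.getLast? = some z) (hd : d ∈ Finset.Icc 1 (D + 1)) (hdz : Free C z d)
    (hdu : Free C u d) :
    Proper E D (Function.update (rotateFan u C l) s(u, z) (some d)) ∧
      (∀ e, Function.update (rotateFan u C l) s(u, z) (some d) e = none → C e = none) ∧
      ∀ v, l.head? = some v → Function.update (rotateFan u C l) s(u, z) (some d) s(u, v) ≠ none := by
  induction l generalizing C with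
  | nil => simp at hz
  | cons x l ih =>
    obtain ⟨v, l', hvl, hv⟩ := hl.head
    obtain ⟨rfl, rfl⟩ := List.cons.inj hvl
    cases l with
    | nil =>
      simp only [List.getLast?_singleton, Option.some.injEq] at hz
      subst hz
      simp only [rotateFan, Function.update_idem]
      refine ⟨hC.update (hl.mem _ (by simp)) hd hdu hdz, fun e he => ?_, by simp⟩
      by_cases h : e = s(u, x)
      · subst h; exact hv
      · rwa [Function.update_of_ne h] at he
    | cons y l =>
      rw [List.getLast?_cons_cons] at hz
      have hch := List.isChain_cons_cons.1 hl.chain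
      obtain ⟨a, hya, hxa⟩ := hch.1
      have hxy : x ≠ y := by
        have := hl.nodup
        simp only [List.nodup_cons, List.mem_cons, not_or] at this
        exact this.1.1
      have hexy : s(u, y) ≠ s(u, x) := fun h => hxy (Sym2.congr_right.1 h).symm
      -- As d is free on the center, it is never among the shifted colors, so it remains free on the
      -- center and on the last vertex.
      have had : a ≠ d := by rintro rfl; exact hdu y hya
      set C₁ := Function.update C s(u, y) none with hC₁
      set C₂ := Function.update C₁ s(u, x) (some a) with hC₂
      have hrot : rotateFan u C (x :: y :: l) = rotateFan u C₂ (y :: l) := by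
        rw [rotateFan, hya, hC₂, hC₁, Function.update_comm hexy, rotateFan_update]
      have hfree₁ : ∀ w b, Free C w b → Free C₁ w b := by
        intro w b hw y' h
        by_cases h' : s(w, y') = s(u, y)
        · rw [hC₁, h'] at h; simp at h
        · rw [hC₁, Function.update_of_ne h'] at h; exact hw _ h
      have hfree₂ : ∀ w b, b ≠ a → Free C w b → Free C₂ w b := by
        intro w b hb hw y' h
        by_cases h' : s(w, y') = s(u, x)
        · rw [hC₂, h', Function.update_self] at h
          exact hb (Option.some.inj h).symm
        · rw [hC₂, Function.update_of_ne h'] at h; exact hfree₁ w b hw _ h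
      have hua : Free C₁ u a := by
        intro y' h
        by_cases h' : s(u, y') = s(u, y)
        · rw [hC₁, h'] at h; simp at h
        · rw [hC₁, Function.update_of_ne h'] at h
          exact h' (by rw [hC.inj u y' y a h hya])
      have hP₂ : Proper E D C₂ :=
        (hC.erase _).update (hl.mem _ (by simp)) (hC.col _ _ hya) hua (hfree₁ x a hxa)
      have hnd := hl.nodup
      have hfan : IsFan E C₂ u (y :: l) := by
        refine ⟨⟨y, l, rfl, ?_⟩, fun x' hx' => hl.mem x' (List.mem_cons_of_mem _ hx'),
          (List.nodup_cons.1 hnd).2, hch.2.imp_of_mem_tail_imp ?_⟩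
        · rw [hC₂, Function.update_of_ne hexy, hC₁, Function.update_self]
        · rintro x' y' hx' hy' ⟨b, hb, hfb⟩
          simp only [List.tail_cons] at hy'
          have hyy : y' ≠ y := by
            rintro rfl
            exact (List.nodup_cons.1 (List.nodup_cons.1 hnd).2).1 hy'
          have hyx : y' ≠ x := by
            rintro rfl
            exact (List.nodup_cons.1 hnd).1 (List.mem_cons_of_mem _ hy')
          refine ⟨b, ?_, hfree₂ _ _ ?_ hfb⟩
          · rw [hC₂, Function.update_of_ne (fun h => hyx (Sym2.congr_right.1 h)), hC₁,
              Function.update_of_ne (fun h => hyy (Sym2.congr_right.1 h)), hb]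
          · rintro rfl
            exact hyy (hC.inj u y' y b hb hya)
      obtain ⟨h1, h2, h3⟩ := ih hP₂ hfan hz (hfree₂ z d had.symm hdz) (hfree₂ u d had.symm hdu)
      rw [hrot]
      have h4 : C₂ s(u, x) ≠ none := by simp [hC₂]
      refine ⟨h1, fun e he => ?_, ?_⟩
      · have h5 := h2 e he
        by_cases hx : e = s(u, x)
        · subst hx; exact hv
        · by_cases hy : e = s(u, y)
          · subst hy; exact absurd he (h3 y rfl)
          · rwa [hC₂, Function.update_of_ne hx, hC₁, Function.update_of_ne hy] at h5
      · simp only [List.head?_cons, Option.some.injEq]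
        rintro v rfl he
        exact h4 (h2 _ he)

/-! ### Inverting an alternating path -/

/-- The color other than `q` among `c` and `d`. -/
def other (c d q : ℕ) : ℕ := if q = d then c else d

/-- The state of the inversion of the alternating path from `u`: `C₀` is the coloring at the start,
`C` the current coloring, and `x :: P` the list of vertices that were visited, latest first. -/
structure PathInv {n : ℕ} (E : List (Sym2 (Fin n))) (D : ℕ) (C₀ C : Sym2 (Fin n) → Option ℕ)
    (u : Fin n) (l : List (Fin n)) (c d : ℕ) (x : Fin n) (z : Option (Fin n)) (q : ℕ)
    (P : List (Fin n)) : Prop where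
  proper₀ : Proper E D C₀
  fan₀ : IsFan E C₀ u l
  last₀ : ∃ z₀, l.getLast? = some z₀ ∧ Free C₀ z₀ d
  hc : c ∈ Finset.Icc 1 (D + 1)
  hd : d ∈ Finset.Icc 1 (D + 1)
  free_c : Free C₀ u c
  used_d : ∃ y ∈ l, C₀ s(u, y) = some d
  ne : c ≠ d
  hq : q = c ∨ q = d
  prev : z = P.head?
  nodup : (x :: P).Nodup
  start : u ∈ x :: P
  -- Between two recolorings the coloring may be improper at one place only: at the current vertex,
  -- the edge just recolored may clash with the next edge of the path.
  almost : ∀ v y y' a, C s(v, y) = some a → C s(v, y') = some a →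
    y = y' ∨ (v = x ∧ a = q ∧ (z = some y ∨ z = some y'))
  free_other : Free C x (other c d q)
  -- The path has no way back into vertices that it has left; the only such edge at the current
  -- vertex is the one by which it arrived.
  closed : ∀ v ∈ P, ∀ y a, a = c ∨ a = d → C s(v, y) = some a → y ∈ x :: P ∧ (y = x → z = some v)
  rel : ∀ e, C e = C₀ e ∨ (C₀ e = some c ∧ C e = some d) ∨ (C₀ e = some d ∧ C e = some c)
  off : ∀ v, v ∉ x :: P → ∀ y, C s(v, y) = C₀ s(v, y)
  inner : ∀ v ∈ P, v ≠ u → ¬ Free C₀ v d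
  last_edge : ∀ z', z = some z' → C s(x, z') = some q ∧ C₀ s(x, z') = some (other c d q)
  at_start : (P = [] ∧ x = u ∧ q = d ∧ C = C₀) ∨
    (x ≠ u ∧ ∃ y, C₀ s(u, y) = some d ∧ C s(u, y) = some c ∧
      ∀ y', y' ≠ y → C s(u, y') = C₀ s(u, y'))

lemma other_ne {c d q : ℕ} (h : c ≠ d) : other c d q ≠ q := by
  unfold other; split_ifs with h'
  · rw [h']; exact h
  · exact Ne.symm h'

lemma other_other {c d q : ℕ} (h : c ≠ d) (hq : q = c ∨ q = d) :
    other c d (other c d q) = q := by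
  unfold other; rcases hq with rfl | rfl <;> simp [h]

lemma other_mem {c d q : ℕ} : other c d q = c ∨ other c d q = d := by
  unfold other; split_ifs <;> simp

variable {C₀ : Sym2 (Fin n) → Option ℕ} {c d q : ℕ} {x : Fin n} {z : Option (Fin n)}
  {P : List (Fin n)}

/-- Maximality of the fan enters here: d is free on its last vertex, so the d-colored edge at the
center must lead into the fan. -/
lemma PathInv.init {z₀ : Fin n} (hC : Proper E D C) (hl : IsFan E C u l)
    (hz : l.getLast? = some z₀)
    (hmax : ∀ x a, x ∉ l → C s(u, x) = some a → ¬ Free C z₀ a)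
    (hc : c ∈ Finset.Icc 1 (D + 1)) (hcu : Free C u c)
    (hd : d ∈ Finset.Icc 1 (D + 1)) (hdz : Free C z₀ d) (hdu : ¬ Free C u d) :
    PathInv E D C C u l c d u none d [] := by
  have hu : ∃ y ∈ l, C s(u, y) = some d := by
    simp only [Free, not_forall, not_not] at hdu
    obtain ⟨y, hy⟩ := hdu
    by_contra hcon
    exact hmax y d (fun h => hcon ⟨y, h, hy⟩) hy hdz
  have hne : c ≠ d := by rintro rfl; exact hdu hcu
  exact {
    proper₀ := hC, fan₀ := hl, last₀ := ⟨z₀, hz, hdz⟩, hc := hc, hd := hd, free_c := hcu,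
    used_d := hu, ne := hne, hq := Or.inr rfl, prev := rfl, nodup := by simp, start := by simp
    almost := fun v y y' a h h' => Or.inl (hC.inj v y y' a h h')
    free_other := by simpa [other] using hcu
    closed := by simp
    rel := fun _ => Or.inl rfl
    off := fun _ _ _ => rfl
    inner := by simp
    last_edge := by simp
    at_start := Or.inl ⟨rfl, rfl, rfl, rfl⟩ }

lemma PathInv.supp (h : PathInv E D C₀ C u l c d x z q P) {e : Sym2 (Fin n)} (he : C e ≠ none) :
    e ∈ E := by
  refine h.proper₀.supp e ?_
  rcases h.rel e with h' | ⟨h', -⟩ | ⟨h', -⟩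
  · rwa [h'] at he
  · simp [h']
  · simp [h']

/-- The next vertex is new, so its edges still have their original colors. Recoloring the edge
removes the clash at x, and the only possible new clash is at y, with the other color. -/
lemma PathInv.step (hE : ∀ e ∈ E, ¬ e.IsDiag) (h : PathInv E D C₀ C u l c d x z q P) {y : Fin n}
    (hy : z ≠ some y) (hxy : C s(x, y) = some q) :
    PathInv E D C₀ (Function.update C s(x, y) (some (other c d q))) u l c d y (some x)
      (other c d q) (x :: P) := by
  have hyx : y ≠ x := by
    rintro rfl
    exact hE _ (h.supp (e := s(y, y)) (by simp [hxy])) (by simp)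
  -- A visited vertex other than x could only be the one just left, by `closed`, and that is
  -- excluded by `hy`.
  have hyP : y ∉ x :: P := by
    intro hmem
    rcases List.mem_cons.1 hmem with h' | h'
    · exact hyx h'
    · exact hy ((h.closed y h' x q h.hq (by rwa [Sym2.eq_swap])).2 rfl)
  have hoff : ∀ w, C s(y, w) = C₀ s(y, w) := h.off y hyP
  have hxy₀ : C₀ s(x, y) = some q := by
    rw [Sym2.eq_swap, ← hoff, Sym2.eq_swap]; exact hxy
  have hcases : ∀ v w, s(v, w) = s(x, y) → (v = x ∧ w = y) ∨ (v = y ∧ w = x) := by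
    intro v w hvw; simpa using hvw
  have hyu : y ≠ u := fun h' => hyP (h' ▸ h.start)
  have hon := other_ne (q := q) h.ne
  have key : ∀ v w w' a, s(v, w) = s(x, y) → s(v, w') ≠ s(x, y) → a = other c d q →
      C s(v, w') = some a → v = y ∧ w = x := by
    intro v w w' a h1 h2 h3 h4
    rcases hcases v w h1 with ⟨rfl, rfl⟩ | h5
    · subst h3; exact absurd h4 (h.free_other w')
    · exact h5
  refine { proper₀ := h.proper₀, fan₀ := h.fan₀, last₀ := h.last₀, hc := h.hc, hd := h.hd,
           free_c := h.free_c, used_d := h.used_d, ne := h.ne, hq := other_mem, prev := rfl,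
           nodup := List.nodup_cons.2 ⟨hyP, h.nodup⟩
           start := List.mem_cons_of_mem _ h.start
           almost := ?_, free_other := ?_, closed := ?_, rel := ?_, off := ?_, inner := ?_,
           last_edge := ?_, at_start := ?_ }
  · intro v w w' a h1 h2
    by_cases e1 : s(v, w) = s(x, y) <;> by_cases e2 : s(v, w') = s(x, y)
    · exact Or.inl (Sym2.congr_right.1 (e1.trans e2.symm))
    · rw [e1, Function.update_self] at h1
      rw [Function.update_of_ne e2] at h2
      have ha : a = other c d q := (Option.some.inj h1).symm
      obtain ⟨rfl, rfl⟩ := key v w w' a e1 e2 ha h2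
      exact Or.inr ⟨rfl, ha, Or.inl rfl⟩
    · rw [e2, Function.update_self] at h2
      rw [Function.update_of_ne e1] at h1
      have ha : a = other c d q := (Option.some.inj h2).symm
      obtain ⟨rfl, rfl⟩ := key v w' w a e2 e1 ha h1
      exact Or.inr ⟨rfl, ha, Or.inr rfl⟩
    · rw [Function.update_of_ne e1] at h1
      rw [Function.update_of_ne e2] at h2
      left
      rcases h.almost v w w' a h1 h2 with h3 | ⟨rfl, rfl, h3⟩
      · exact h3
      · rcases h3 with h3 | h3
        · rcases h.almost v y w' a hxy h2 with rfl | ⟨-, -, h4⟩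
          · exact absurd rfl e2
          · rcases h4 with h4 | h4
            · exact absurd h4 hy
            · exact Option.some.inj (h3.symm.trans h4)
        · rcases h.almost v y w a hxy h1 with rfl | ⟨-, -, h4⟩
          · exact absurd rfl e1
          · rcases h4 with h4 | h4
            · exact absurd h4 hy
            · exact Option.some.inj (h4.symm.trans h3)
  · intro w hw
    rw [other_other h.ne h.hq] at hw
    by_cases e1 : s(y, w) = s(x, y)
    · rw [e1, Function.update_self] at hw
      exact hon (Option.some.inj hw)
    · rw [Function.update_of_ne e1] at hw
      rcases h.almost y w x q hw (by rwa [Sym2.eq_swap]) with rfl | ⟨h3, -⟩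
      · exact e1 Sym2.eq_swap
      · exact hyx h3
  · intro v hv w a ha hw
    by_cases e1 : s(v, w) = s(x, y)
    · rcases hcases v w e1 with ⟨rfl, rfl⟩ | ⟨rfl, rfl⟩
      · exact ⟨by simp, fun _ => rfl⟩
      · exact absurd hv hyP
    · rw [Function.update_of_ne e1] at hw
      have hw' : w ∈ x :: P := by
        rcases List.mem_cons.1 hv with rfl | hv
        · have haq : a = q ∨ a = other c d q := by
            unfold other; rcases h.hq with rfl | rfl <;> rcases ha with rfl | rfl <;> simp [h.ne]
          rcases haq with rfl | rfl
          · rcases h.almost v y w a hxy hw with rfl | ⟨-, -, h4⟩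
            · exact absurd rfl e1
            · rcases h4 with h4 | h4
              · exact absurd h4 hy
              · rw [h.prev] at h4
                exact List.mem_cons_of_mem _ (List.mem_of_mem_head? h4)
          · exact absurd hw (h.free_other w)
        · exact (h.closed v hv w a ha hw).1
      exact ⟨List.mem_cons_of_mem _ hw', fun h' => absurd (h' ▸ hw') hyP⟩
  · intro e
    by_cases e1 : e = s(x, y)
    · subst e1
      rw [Function.update_self, hxy₀]
      unfold other
      rcases h.hq with rfl | rfl <;> simp [h.ne]
    · rw [Function.update_of_ne e1]; exact h.rel e
  · intro v hv w
    simp only [List.mem_cons, not_or] at hv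
    rw [Function.update_of_ne, h.off v (by simp [hv.2])]
    intro e1
    rcases hcases v w e1 with h' | h'
    · exact hv.2.1 h'.1
    · exact hv.1 h'.1
  · intro v hv hvu
    rcases List.mem_cons.1 hv with rfl | hv
    -- The vertex becoming inner originally had path edges of both colors: the one by which the path
    -- came and the one by which it leaves. One of them had color d.
    · have hP : P ≠ [] := by
        rintro rfl
        exact hvu (List.mem_singleton.1 h.start).symm
      obtain ⟨z', P', rfl⟩ := List.exists_cons_of_ne_nil hP
      have h3 := (h.last_edge z' h.prev).2
      intro hf
      rcases h.hq with rfl | rfl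
      · refine hf z' ?_
        rw [h3]; simp [other, h.ne]
      · exact hf y hxy₀
    · exact h.inner v hv hvu
  · simp only [Option.some.injEq]
    rintro z' rfl
    rw [other_other h.ne h.hq, Sym2.eq_swap (a := y)]
    exact ⟨by simp, hxy₀⟩
  · right
    refine ⟨hyu, ?_⟩
    rcases h.at_start with ⟨rfl, rfl, rfl, rfl⟩ | ⟨hxu, y₁, h1, h2, h3⟩
    · refine ⟨y, hxy, by simp [other], fun y' hy' => ?_⟩
      rw [Function.update_of_ne]
      exact fun h' => hy' (Sym2.congr_right.1 h')
    · have hne : ∀ w, s(u, w) ≠ s(x, y) := by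
        intro w hw
        rcases hcases u w hw with h' | h'
        · exact hxu h'.1.symm
        · exact hyu h'.1.symm
      refine ⟨y₁, h1, ?_, fun y' hy' => ?_⟩
      · rwa [Function.update_of_ne (hne _)]
      · rw [Function.update_of_ne (hne _)]; exact h3 y' hy'

/-- Only one edge at the center changes: that to y₀, from d to c. Let p precede y₀ in the fan;
originally d was free on p. If it still is, the fan up to p serves. If not, the path ended in p, so
c is now free on p and the whole fan is still a fan; its last vertex was not on the path and still
has d free. -/
lemma PathInv.finish (hE : ∀ e ∈ E, ¬ e.IsDiag) (h : PathInv E D C₀ C u l c d x z q P)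
    (hmax : ∀ y, z ≠ some y → C s(x, y) ≠ some q) :
    Proper E D C ∧ Free C u d ∧ IsFan E C u (shrinkFan C d l) ∧
      ∀ z', (shrinkFan C d l).getLast? = some z' → Free C z' d := by
  obtain ⟨y₀, hy₀l, hy₀⟩ := h.used_d
  obtain ⟨hxu, y₁, hy₁, hy₁c, hrest⟩ : x ≠ u ∧ ∃ y, C₀ s(u, y) = some d ∧ C s(u, y) = some c ∧
      ∀ y', y' ≠ y → C s(u, y') = C₀ s(u, y') := by
    rcases h.at_start with ⟨rfl, rfl, rfl, rfl⟩ | h'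
    · exact absurd hy₀ (hmax y₀ (by rw [h.prev]; simp))
    · exact h'
  obtain rfl := h.proper₀.inj u y₀ y₁ d hy₀ hy₁
  have hC : Proper E D C := by
    refine ⟨fun e => h.supp, fun e a hea => ?_, fun v y y' a h1 h2 => ?_⟩
    · rcases h.rel e with h' | ⟨-, h'⟩ | ⟨-, h'⟩
      · exact h.proper₀.col e a (h' ▸ hea)
      · rw [h'] at hea; exact Option.some.inj hea ▸ h.hd
      · rw [h'] at hea; exact Option.some.inj hea ▸ h.hc
    · rcases h.almost v y y' a h1 h2 with h3 | ⟨rfl, rfl, h3⟩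
      · exact h3
      · have hz : ∀ w, C s(v, w) = some a → z = some w := fun w hw => by
          by_contra hcon; exact hmax w hcon hw
        exact Option.some.inj ((hz y h1).symm.trans (hz y' h2))
  have hud : Free C u d := by
    intro w hw
    by_cases hwy : w = y₀
    · rw [hwy, hy₁c] at hw; exact h.ne (Option.some.inj hw)
    · rw [hrest w hwy] at hw
      exact hwy (h.proper₀.inj u w y₀ d hw hy₀)
  have hul : u ∉ l := fun hu => hE _ (h.fan₀.mem u hu) (by simp)
  obtain ⟨v, l', hvl, hv⟩ := h.fan₀.head
  have hy₀l' : y₀ ∈ l' := by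
    rw [hvl] at hy₀l
    rcases List.mem_cons.1 hy₀l with rfl | h'
    · rw [hv] at hy₀; simp at hy₀
    · exact h'
  obtain ⟨A, p, B, hl⟩ : ∃ A p B, l = A ++ p :: y₀ :: B := by
    obtain ⟨A', B, rfl⟩ := List.append_of_mem hy₀l'
    rcases List.eq_nil_or_concat (v :: A') with h' | ⟨A, p, hA⟩
    · simp at h'
    · refine ⟨A, p, B, ?_⟩
      rw [hvl, ← List.cons_append, hA]; simp
  have hnd := h.fan₀.nodup
  have hchain := h.fan₀.chain
  have hpl : p ∈ l := by rw [hl]; simp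
  have hsplit := hchain
  rw [hl, List.isChain_split, List.isChain_cons_cons] at hsplit
  obtain ⟨hch1, hpy, hch2⟩ := hsplit
  have hpd₀ : Free C₀ p d := by
    obtain ⟨a, ha, hf⟩ := hpy
    rw [hy₀] at ha
    obtain rfl := Option.some.inj ha
    exact hf
  -- All other fan colors differ from c, which is free on the center, and from d, which is used
  -- there only towards y₀. The inversion does not affect whether such colors are free.
  have htrans : ∀ a b, b ≠ y₀ → (∃ α, C₀ s(u, b) = some α ∧ Free C₀ a α) →
      ∃ α, C s(u, b) = some α ∧ Free C a α := by
    rintro a b hb ⟨α, hα, hf⟩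
    refine ⟨α, by rw [hrest b hb, hα], fun w hw => ?_⟩
    have h1 : α ≠ c := by rintro rfl; exact h.free_c b hα
    have h2 : α ≠ d := by rintro rfl; exact hb (h.proper₀.inj u b y₀ α hα hy₀)
    rcases h.rel s(a, w) with h' | ⟨-, h'⟩ | ⟨-, h'⟩
    · exact hf w (h' ▸ hw)
    · rw [h'] at hw; exact h2 (Option.some.inj hw).symm
    · rw [h'] at hw; exact h1 (Option.some.inj hw).symm
  have hvy : v ≠ y₀ := by rintro rfl; rw [hv] at hy₀; simp at hy₀
  have hCv : C s(u, v) = none := by rw [hrest v hvy, hv]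
  obtain ⟨l₁, hl₁, hl₁p, hfan, hfree⟩ : ∃ l₁, shrinkFan C d l = shrinkFan C d l₁ ∧ l₁ ≠ [] ∧
      IsFan E C u l₁ ∧ ∃ w ∈ l₁, Free C w d := by
    have hndl := hnd
    rw [hl] at hnd
    have hnd' := List.nodup_append.1 hnd
    by_cases hpd : Free C p d
    · have hpre : A ++ [p] <+: l := ⟨y₀ :: B, by rw [hl]; simp⟩
      have hpre₀ := h.fan₀.prefix hpre (by simp)
      refine ⟨A ++ [p], by rw [hl, shrinkFan_append hpd], by simp, ⟨?_, hpre₀.mem, hpre₀.nodup,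
        hch1.imp_of_mem_imp fun a b _ hb => htrans a b ?_⟩, p, by simp, hpd⟩
      · obtain ⟨v', l'', hv', hv''⟩ := hpre₀.head
        have : v' = v := by
          rw [hv', hvl] at hpre; exact (List.cons_prefix_cons.1 hpre).1
        exact ⟨v', l'', hv', by rw [this, hCv]⟩
      · rintro rfl
        rcases List.mem_append.1 hb with hb | hb
        · exact hnd'.2.2 b hb b (by simp) rfl
        · obtain rfl := List.mem_singleton.1 hb
          simp at hnd'
    · have hpP : p ∈ x :: P := by
        by_contra hcon
        refine hpd fun w hw => hpd₀ w ?_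
        rw [← h.off p hcon]; exact hw
      have hpu : p ≠ u := by rintro rfl; exact hul hpl
      -- A visited vertex that is neither the center nor the end uses d originally, whereas d was
      -- free on p.
      have hpx : p = x := by
        rcases List.mem_cons.1 hpP with h' | h'
        · exact h'
        · exact absurd hpd₀ (h.inner p h' hpu)
      have hpc : Free C p c := by
        have := h.free_other
        rcases h.hq with rfl | rfl
        · rw [other, if_neg h.ne, ← hpx] at this; exact absurd this hpd
        · rw [other, if_pos rfl, ← hpx] at this; exact this
      obtain ⟨z₀, hz₀, hz₀d⟩ := h.last₀
      have hz₀m : z₀ ∈ y₀ :: B := by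
        rw [hl, List.getLast?_append_of_ne_nil _ (by simp), List.getLast?_cons_cons] at hz₀
        exact List.mem_of_getLast? hz₀
      have hz₀l : z₀ ∈ l := by
        rw [hl]
        exact List.mem_append_right _ (List.mem_cons_of_mem _ hz₀m)
      have hz₀p : z₀ ≠ p := by
        rintro rfl
        exact (List.nodup_cons.1 hnd'.2.1).1 hz₀m
      have hz₀P : z₀ ∉ x :: P := by
        intro hmem
        rcases List.mem_cons.1 hmem with h' | h'
        · exact hz₀p (h'.trans hpx.symm)
        · exact h.inner z₀ h' (by rintro rfl; exact hul hz₀l) hz₀d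
      refine ⟨l, rfl, by rw [hvl]; simp, ⟨⟨v, l', hvl, hCv⟩, h.fan₀.mem, hndl, ?_⟩, z₀, hz₀l,
        fun w hw => hz₀d w (by rw [← h.off z₀ hz₀P]; exact hw)⟩
      rw [hl, List.isChain_split, List.isChain_cons_cons]
      refine ⟨hch1.imp_of_mem_imp fun a b _ hb => htrans a b ?_, ⟨c, hy₁c, hpc⟩,
        hch2.imp_of_mem_tail_imp fun a b _ hb => htrans a b ?_⟩
      · rintro rfl
        rcases List.mem_append.1 hb with hb | hb
        · exact hnd'.2.2 b hb b (by simp) rfl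
        · obtain rfl := List.mem_singleton.1 hb
          simp at hnd'
      · rintro rfl
        exact (List.nodup_cons.1 (List.nodup_cons.1 hnd'.2.1).2).1 hb
  rw [hl₁]
  exact ⟨hC, hud, hfan.prefix (shrinkFan_prefix C d l₁) (shrinkFan_ne_nil C d hl₁p),
    fun z' hz' => free_of_getLast?_shrinkFan hfree hz'⟩

lemma PathInv.eq_none_iff (h : PathInv E D C₀ C u l c d x z q P) (e : Sym2 (Fin n)) :
    C e = none ↔ C₀ e = none := by
  rcases h.rel e with h' | ⟨h', h''⟩ | ⟨h', h''⟩
  · rw [h']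
  · simp [h', h'']
  · simp [h', h'']

end

/-! ### The invariant of the algorithm -/

/-- The facts about the history `H` of pushed edges when `rest` is still to be read. -/
structure Core {n k : ℕ} (G : SimpleGraph (Fin n)) (w : Sym2 (Fin n) → ℝ) (δ : ℝ)
    (rest : List (Item n)) (H : List (Rec n k)) (m : Mem n k) : Prop where
  valid : Valid δ H
  nodup : (H.map Rec.edge).Nodup
  mem : ∀ h ∈ H, h.edge ∈ G.edgeSet
  wt : ∀ h ∈ H, h.a.wt = w h.edge
  fresh : ∀ h ∈ H, h.edge ∉ rest.map Item.edge
  cover : ∀ e ∈ G.edgeSet,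
    e ∈ rest.map Item.edge ∨ e ∈ H.map Rec.edge ∨ Covered δ w H e
  phi : ∀ x q, m.phi x q = level H x q
  ptr : PtrOK m.p H
  ptr_supp : ∀ x e, m.p x e ≠ none → ∃ h ∈ H, e = h.edge ∧ x ∈ e
  flag_supp : ∀ e, m.flag e ≠ none → e ∈ H.map Rec.edge

/-- The facts about the unread part of the stream. -/
structure RestOK {n : ℕ} (G : SimpleGraph (Fin n)) (w : Sym2 (Fin n) → ℝ) (rest : List (Item n)) :
    Prop where
  nodup : (rest.map Item.edge).Nodup
  mem : ∀ a ∈ rest, a.edge ∈ G.edgeSet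
  wt : ∀ a ∈ rest, a.wt = w a.edge

/-- The facts about the variables that the streaming phase and the unwinding do not use. -/
structure Unstarted {n k : ℕ} (m : Mem n k) : Prop where
  maxDeg : m.maxDeg = 0
  color : ∀ e, m.color e = none

/-- The facts about the result `F` of the unwinding. -/
structure Taken {n k : ℕ} (H : List (Rec n k)) (m : Mem n k) : Prop where
  sub : ∀ a ∈ m.F, ∃ h ∈ H, h.a = a
  nodup : (m.F.map Item.edge).Nodup
  deg : maxDegree m.F ≤ k
  wt : (H.map Rec.g).sum ≤ (m.F.map Item.wt).sum
  stack : m.stack = []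
  maxDeg : m.maxDeg = maxDegree m.F

/-- The weight of a color class. -/
noncomputable def classWeight {n : ℕ} (F : List (Item n)) (C : Sym2 (Fin n) → Option ℕ) (c : ℕ) : ℝ :=
  ((F.filter fun a => C a.edge = some c).map Item.wt).sum

/-- The invariant of the individual phases, with a value `t` that decreases lexicographically. -/
def PhaseInv {n k : ℕ} (G : SimpleGraph (Fin n)) (w : Sym2 (Fin n) → ℝ)
    (rest : List (Item n)) (H : List (Rec n k)) (m : Mem n k) (t : ℕ × ℕ × ℕ) : Phase n → Prop
  -- The first component of `t` numbers the stages downwards. The second counts unread edges, edges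
  -- on the stack, uncolored edges, or edges still to be summed; the third measures progress inside
  -- one chase, fan or path.
  | .stream => RestOK G w rest ∧ (∀ x q, m.t x q = top (queue H x q)) ∧
      m.stack = H.map Rec.a ∧ m.F = [] ∧ Unstarted m ∧ t = (4, rest.length, 0)
  | .unwind => rest = [] ∧ ∃ H₁ H₂ Fr, H = H₁ ++ H₂ ∧ m.stack = H₂.map Rec.a ∧ m.F = Fr.map Rec.a ∧
      Unstarted m ∧ Unwound H₁ H₂ Fr m.flag ∧ t = (3, H₂.length, 0)
  | .chase a x cp => rest = [] ∧ ∃ H₁ f H₂ Fr flag₀ R, H = H₁ ++ f :: H₂ ∧ f.a = a ∧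
      m.stack = H₂.map Rec.a ∧ m.F = (f :: Fr).map Rec.a ∧ Unstarted m ∧
      Unwound H₁ (f :: H₂) Fr flag₀ ∧ flag₀ f.edge = some true ∧ Chased f H₂ flag₀ m.flag ∧
      cp = top R ∧
      -- `R` is the part of the queue not yet chased, and every edge of the queue with a true flag
      -- lies in it. The offset exceeds the cost of the second chase, which starts from a queue of
      -- at most `H.length` edges.
      ((x = f.a.u ∧ R <:+ queue (f :: H₂) f.a.u f.i ∧
          (∀ h ∈ H₂, m.flag h.edge = some true → h.InQ f.a.u f.i → h ∈ R) ∧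
          t = (3, H₂.length, R.length + H.length + 3)) ∨
        (x = f.a.v ∧ R <:+ queue (f :: H₂) f.a.v f.j ∧
          (∀ h ∈ H₂, m.flag h.edge = some true →
            ¬ h.InQ f.a.u f.i ∧ (h.InQ f.a.v f.j → h ∈ R)) ∧
          t = (3, H₂.length, R.length + 1)))
  | .coloring => rest = [] ∧ Taken H m ∧ Proper (m.F.map Item.edge) m.maxDeg m.color ∧
      -- This offset exceeds all values of the fan phase, and the offset there exceeds all those of
      -- the path phase. Fans and paths have no repeated vertices, so the subtractions below are not
      -- truncated where a decrease is needed.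
      t = (2, uncolored (m.F.map Item.edge) m.color, 2 * n + 5)
  | .fan u l => rest = [] ∧ Taken H m ∧ Proper (m.F.map Item.edge) m.maxDeg m.color ∧
      IsFan (m.F.map Item.edge) m.color u l ∧
      t = (2, uncolored (m.F.map Item.edge) m.color, n + 2 + (n + 1 - l.length))
  | .path u l c d x z q => rest = [] ∧ Taken H m ∧ ∃ C₀ P,
      PathInv (m.F.map Item.edge) m.maxDeg C₀ m.color u l c d x z q P ∧
      t = (2, uncolored (m.F.map Item.edge) m.color, n + 1 - P.length)
  | .select l s => rest = [] ∧ Taken H m ∧ Proper (m.F.map Item.edge) m.maxDeg m.color ∧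
      (∀ a ∈ m.F, m.color a.edge ≠ none) ∧ m.maxDeg = k ∧
      (∃ F₁, m.F = F₁ ++ l ∧ ∀ c, s c = classWeight F₁ m.color c) ∧ t = (1, l.length, 0)
  | .halt => rest = [] ∧ Taken H m ∧ Proper (m.F.map Item.edge) k m.color ∧
      (∀ a ∈ m.F, m.color a.edge ≠ none) ∧
      ((k : ℝ) + 1) * classWeight m.F m.color (k + 1) ≤ (m.F.map Item.wt).sum ∧ t = (0, 0, 0)

/-- The invariant of the whole algorithm. -/
def Inv {n k : ℕ} (G : SimpleGraph (Fin n)) (w : Sym2 (Fin n) → ℝ) (δ : ℝ) (c : Config n k)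
    (t : ℕ × ℕ × ℕ) : Prop :=
  ∃ H : List (Rec n k), Core G w δ c.1 H c.2 ∧ PhaseInv G w c.1 H c.2 t c.2.phase

/-- The lexicographic order. -/
def LexLt (s t : ℕ × ℕ × ℕ) : Prop :=
  s.1 < t.1 ∨ s.1 = t.1 ∧ (s.2.1 < t.2.1 ∨ s.2.1 = t.2.1 ∧ s.2.2 < t.2.2)

lemma lexLt_wf : WellFounded LexLt := by
  have h : WellFounded (Prod.Lex (· < · : ℕ → ℕ → Prop) (Prod.Lex (· < · : ℕ → ℕ → Prop)
      (· < · : ℕ → ℕ → Prop))) :=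
    (Prod.lex ⟨_, wellFounded_lt⟩ ⟨_, (Prod.lex ⟨_, wellFounded_lt⟩ ⟨_, wellFounded_lt⟩).wf⟩).wf
  refine Subrelation.wf ?_ h
  intro s t hst
  rw [Prod.lex_def, Prod.lex_def]
  exact hst

section
variable {n k : ℕ} {G : SimpleGraph (Fin n)} {w : Sym2 (Fin n) → ℝ} {δ ε : ℝ}
  {rest l : List (Item n)} {H : List (Rec n k)} {m m' : Mem n k} {t : ℕ × ℕ × ℕ}

lemma inv_init (hl : IsStream G w l) : ∃ t, Inv G w δ (l, initMem n k) t := by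
  obtain ⟨hnd, hmem, hwt⟩ := hl
  refine ⟨(4, l.length, 0), [], ?_, ?_⟩
  · exact ⟨trivial, by simp, by simp, by simp, by simp, fun e he => Or.inl ((hmem e).2 he),
      fun _ _ => rfl, trivial, by simp [initMem], by simp [initMem]⟩
  · exact ⟨⟨hnd, fun a ha => (hmem _).1 (List.mem_map_of_mem ha), hwt⟩, fun _ _ => rfl, rfl, rfl,
      ⟨rfl, fun _ => rfl⟩, rfl⟩

lemma Item.ne_of_mem {a : Item n} (h : a.edge ∈ G.edgeSet) : a.u ≠ a.v := by
  rw [Item.edge, SimpleGraph.mem_edgeSet] at h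
  exact h.ne

lemma Core.push (hδ : 0 < δ) (hw : ∀ e ∈ G.edgeSet, 0 < w e) {a : Item n}
    (hC : Core G w δ (a :: rest) H m) (hR : RestOK G w (a :: rest))
    (ht : ∀ x q, m.t x q = top (queue H x q)) {i j : Fin k}
    (hi : ∀ q, m.phi a.u i ≤ m.phi a.u q) (hj : ∀ q, m.phi a.v j ≤ m.phi a.v q)
    (h : (1 + δ) * (m.phi a.u i + m.phi a.v j) ≤ a.wt) :
    let r : Rec n k := ⟨a, i, j, a.wt - (m.phi a.u i + m.phi a.v j)⟩
    Core G w δ rest (r :: H) (m.push a i j) ∧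
      ∀ x q, (m.push a i j).t x q = top (queue (r :: H) x q) := by
  intro r
  have hmem : a.edge ∈ G.edgeSet := hR.mem a List.mem_cons_self
  have hwt : a.wt = w a.edge := hR.wt a List.mem_cons_self
  have hne : a.u ≠ a.v := Item.ne_of_mem hmem
  have hre : r.edge = a.edge := rfl
  have hfr : ∀ h ∈ H, h.edge ≠ a.edge ∧ h.edge ∉ rest.map Item.edge := by
    intro h hh
    simpa using hC.fresh h hh
  have hnd := hR.nodup
  rw [List.map_cons, List.nodup_cons] at hnd
  have hv : Valid δ (r :: H) := by
    refine ⟨⟨hne, hwt ▸ hw _ hmem, ?_, ?_, ?_, ?_⟩, hC.valid⟩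
    · simp only [r, hC.phi]
    · simpa only [r, hC.phi] using hi
    · simpa only [r, hC.phi] using hj
    · simpa only [r, hC.phi] using h
  refine ⟨{ valid := hv, nodup := ?_, mem := ?_, wt := ?_, fresh := ?_, cover := ?_, phi := ?_,
            ptr := ?_, ptr_supp := ?_, flag_supp := ?_ }, ?_⟩
  · rw [List.map_cons, List.nodup_cons]
    refine ⟨fun hcon => ?_, hC.nodup⟩
    obtain ⟨h', hh', he⟩ := List.mem_map.1 hcon
    exact (hfr h' hh').1 he
  · simpa [hre] using ⟨hmem, hC.mem⟩
  · simpa [hre] using ⟨hwt, hC.wt⟩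
  · intro h' hh'
    rcases List.mem_cons.1 hh' with rfl | hh'
    · exact hnd.1
    · exact (hfr h' hh').2
  · intro e he
    rcases hC.cover e he with h' | h' | h'
    · rw [List.map_cons, List.mem_cons] at h'
      rcases h' with rfl | h'
      · exact Or.inr (Or.inl (by simp [hre]))
      · exact Or.inl h'
    · exact Or.inr (Or.inl (List.mem_cons_of_mem _ h'))
    · exact Or.inr (Or.inr (h'.cons hδ hv))
  · intro x q
    rw [level_cons]
    have hrg : r.g = a.wt - (m.phi a.u i + m.phi a.v j) := rfl
    simp only [Mem.push]
    by_cases h1 : x = a.u ∧ q = i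
    · have hq : r.InQ x q := Or.inl h1
      rw [if_pos h1, if_pos hq, h1.1, h1.2, hrg, hC.phi a.u i, add_comm]
    · rw [if_neg h1]
      by_cases h2 : x = a.v ∧ q = j
      · have hq : r.InQ x q := Or.inr h2
        rw [if_pos h2, if_pos hq, h2.1, h2.2, hrg, hC.phi a.v j, add_comm]
      · have hq : ¬ r.InQ x q := fun h' => h'.elim h1 h2
        rw [if_neg h2, if_neg hq, hC.phi, zero_add]
  · refine ⟨?_, ?_, hC.ptr.congr fun h' hh' x => ?_⟩
    · simp [Mem.push, hre, ht, r]
    · simp [Mem.push, hre, ht, r, hne.symm]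
    · simp [Mem.push, (hfr h' hh').1]
  · intro x e he
    simp only [Mem.push] at he
    split_ifs at he with h1 h2
    · exact ⟨r, List.mem_cons_self, h1.1, by rw [h1.1, h1.2]; simp [Item.edge]⟩
    · exact ⟨r, List.mem_cons_self, h2.1, by rw [h2.1, h2.2]; simp [Item.edge]⟩
    · obtain ⟨h', hh', he'⟩ := hC.ptr_supp x e he
      exact ⟨h', List.mem_cons_of_mem _ hh', he'⟩
  · intro e he
    exact List.mem_cons_of_mem _ (hC.flag_supp e he)
  · intro x q
    rw [queue_cons]
    simp only [Mem.push]
    by_cases hq : r.InQ x q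
    · rw [if_pos hq, if_pos (show _ ∨ _ from hq)]; rfl
    · rw [if_neg hq, if_neg (show ¬ (_ ∨ _) from hq)]; exact ht x q

/-- The test fails for the lowest queues, hence for every pair of queues at the endpoints. Levels
never decrease, so the edge remains covered until the end. -/
lemma Core.skip {a : Item n} (hδ : 0 < δ)
    (hC : Core G w δ (a :: rest) H m) (hR : RestOK G w (a :: rest))
    {i j : Fin k} (hi : ∀ q, m.phi a.u i ≤ m.phi a.u q) (hj : ∀ q, m.phi a.v j ≤ m.phi a.v q)
    (h : a.wt < (1 + δ) * (m.phi a.u i + m.phi a.v j)) : Core G w δ rest H m :=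
  { hC with
    fresh := fun h' hh' => fun hcon => hC.fresh h' hh' (List.mem_cons_of_mem _ hcon)
    cover := by
      intro e he
      rcases hC.cover e he with h' | h'
      · rw [List.map_cons, List.mem_cons] at h'
        rcases h' with rfl | h'
        · refine Or.inr (Or.inr ⟨a.u, a.v, Item.ne_of_mem he, rfl, fun q q' => ?_⟩)
          rw [← hR.wt a List.mem_cons_self, ← hC.phi, ← hC.phi]
          refine h.le.trans ?_
          have h1 := hi q
          have h2 := hj q'
          gcongr
        · exact Or.inl h'
      · exact Or.inr h' }

lemma RestOK.tail {a : Item n} (hR : RestOK G w (a :: rest)) : RestOK G w rest :=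
  ⟨(List.nodup_cons.1 hR.nodup).2, fun b hb => hR.mem b (List.mem_cons_of_mem _ hb),
    fun b hb => hR.wt b (List.mem_cons_of_mem _ hb)⟩

lemma maxDegree_le_iff {F : List (Item n)} {D : ℕ} :
    maxDegree F ≤ D ↔ ∀ x, ((F.map Item.edge).filter fun e => x ∈ e).length ≤ D := by
  simp [maxDegree, Finset.sup_le_iff, List.filter_map, Function.comp_def]

lemma Taken.degree (hT : Taken H m) (x : Fin n) :
    ((m.F.map Item.edge).filter fun e => x ∈ e).length ≤ m.maxDeg :=
  maxDegree_le_iff.1 hT.maxDeg.ge x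

lemma Taken.not_isDiag (hC : Core G w δ rest H m) (hT : Taken H m) :
    ∀ e ∈ m.F.map Item.edge, ¬ e.IsDiag := by
  intro e he
  obtain ⟨a, ha, rfl⟩ := List.mem_map.1 he
  obtain ⟨h, hh, rfl⟩ := hT.sub a ha
  exact G.not_isDiag_of_mem_edgeSet (hC.mem h hh)

lemma Unwound.taken (hC : Core G w δ rest H m) {Fr : List (Rec n k)}
    (hU : Unwound H [] Fr m.flag) (hF : m.F = Fr.map Rec.a) (hm' : m'.F = m.F)
    (hS : m'.stack = []) (hD : m'.maxDeg = maxDegree m.F) : Taken H m' where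
  sub := by
    intro a ha
    rw [hm', hF] at ha
    obtain ⟨f, hf, rfl⟩ := List.mem_map.1 ha
    exact ⟨f, hU.sub f hf, rfl⟩
  nodup := by
    rw [hm', hF, List.map_map, List.Nodup, List.pairwise_map]
    refine hU.pair.imp_of_mem fun {f f'} hf hf' hff he => ?_
    have := eq_of_edge_eq hC.nodup (hU.sub f hf) (hU.sub f' hf') he
    exact hff _ _ f.inQ_u (this ▸ f.inQ_u)
  deg := by
    rw [hm', hF, maxDegree_le_iff]
    intro x
    rw [List.map_map, List.filter_map, List.length_map]
    exact degree_le_of_pairwise hU.pair x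
  wt := by
    have := hU.wt
    simp only [List.map_nil, List.sum_nil, add_zero] at this
    rw [hm', hF, List.map_map]
    exact this
  stack := hS
  maxDeg := by rw [hD, hm']

lemma Taken.congr (hT : Taken H m) (hF : m'.F = m.F) (hS : m'.stack = m.stack)
    (hD : m'.maxDeg = m.maxDeg) : Taken H m' where
  sub := by rw [hF]; exact hT.sub
  nodup := by rw [hF]; exact hT.nodup
  deg := by rw [hF]; exact hT.deg
  wt := by rw [hF]; exact hT.wt
  stack := by rw [hS]; exact hT.stack
  maxDeg := by rw [hF, hD]; exact hT.maxDeg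

lemma Core.congr (hC : Core G w δ rest H m) (h1 : m'.phi = m.phi) (h2 : m'.p = m.p)
    (h3 : m'.flag = m.flag) : Core G w δ rest H m' :=
  { hC with
    phi := by rw [h1]; exact hC.phi
    ptr := by rw [h2]; exact hC.ptr
    ptr_supp := by rw [h2]; exact hC.ptr_supp
    flag_supp := by rw [h3]; exact hC.flag_supp }

lemma sum_classWeight {F : List (Item n)} {C : Sym2 (Fin n) → Option ℕ} {S : Finset ℕ}
    (h : ∀ a ∈ F, ∃ c ∈ S, C a.edge = some c) :
    ∑ c ∈ S, classWeight F C c = (F.map Item.wt).sum := by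
  induction F with
  | nil => simp [classWeight]
  | cons a F ih =>
    have ih' := ih fun b hb => h b (List.mem_cons_of_mem _ hb)
    obtain ⟨c₀, hc₀, hac⟩ := h a List.mem_cons_self
    have h1 : ∀ c, classWeight (a :: F) C c = (if c = c₀ then a.wt else 0) + classWeight F C c := by
      intro c
      by_cases hc : c = c₀
      · subst hc; simp [classWeight, hac]
      · have : c₀ ≠ c := Ne.symm hc
        simp [classWeight, hac, hc, this]
    simp_rw [h1, Finset.sum_add_distrib]
    rw [ih', Finset.sum_ite_eq' S c₀, if_pos hc₀]
    simp

lemma classWeight_append (F F' : List (Item n)) (C : Sym2 (Fin n) → Option ℕ) (c : ℕ) :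
    classWeight (F ++ F') C c = classWeight F C c + classWeight F' C c := by
  simp [classWeight]

lemma Taken.wt_nonneg (hC : Core G w δ rest H m) (hT : Taken H m) : ∀ a ∈ m.F, 0 ≤ a.wt := by
  intro a ha
  obtain ⟨h, hh, rfl⟩ := hT.sub a ha
  exact (hC.valid.wt_pos hh).le

lemma Proper.exchange {E : List (Sym2 (Fin n))} {D : ℕ} {C : Sym2 (Fin n) → Option ℕ}
    (hC : Proper E D C) {c : ℕ} (hc : c ∈ Finset.Icc 1 (D + 1)) :
    Proper E D fun e => (C e).map (Equiv.swap c (D + 1)) where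
  supp := fun e he => hC.supp e (by rintro h; simp [h] at he)
  col := by
    intro e a h
    simp only [Option.map_eq_some_iff] at h
    obtain ⟨b, hb, rfl⟩ := h
    have := hC.col e b hb
    rw [Equiv.swap_apply_def]
    split_ifs
    · simp
    · exact hc
    · exact this
  inj := by
    intro v y y' a h h'
    simp only [Option.map_eq_some_iff] at h h'
    obtain ⟨b, hb, rfl⟩ := h
    obtain ⟨b', hb', he⟩ := h'
    obtain rfl := (Equiv.swap c (D + 1)).injective he
    exact hC.inj v y y' _ hb hb'

/-! ### Every step preserves the invariant -/

lemma Inv.step_read (hδ : 0 < δ) (hw : ∀ e ∈ G.edgeSet, 0 < w e) {a : Item n}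
    (hI : Inv G w δ (a :: rest, m) t) (hp : m.phase = Phase.stream) (h : Arrive (2 * δ) a m m') :
    ∃ t', LexLt t' t ∧ Inv G w δ (rest, m') t' := by
  obtain ⟨H, hC, hP⟩ := hI
  simp only [hp] at hP
  obtain ⟨hR, ht, hS, hF, hU, rfl⟩ := hP
  have hδ' : 2 * δ / 2 = δ := by ring
  refine ⟨(4, rest.length, 0), by simp [LexLt], ?_⟩
  cases h with
  | push i j hi hj h =>
    rw [hδ'] at h
    obtain ⟨h1, h2⟩ := hC.push hδ hw hR ht hi hj h
    refine ⟨_, h1, ?_⟩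
    have : (m.push a i j).phase = Phase.stream := hp
    simp only [this]
    exact ⟨hR.tail, h2, by simp [Mem.push, hS], hF, ⟨hU.maxDeg, hU.color⟩, rfl⟩
  | skip i j hi hj h =>
    rw [hδ'] at h
    refine ⟨H, hC.skip hδ hR hi hj h, ?_⟩
    simp only [hp]
    exact ⟨hR.tail, ht, hS, hF, hU, rfl⟩

lemma Inv.step_end (hI : Inv G w δ ([], m) t) (hp : m.phase = Phase.stream) :
    ∃ t', LexLt t' t ∧ Inv G w δ ([], m.startUnwind) t' := by
  obtain ⟨H, hC, hP⟩ := hI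
  simp only [hp] at hP
  obtain ⟨hR, ht, hS, hF, hU, rfl⟩ := hP
  have hmap : m.stack.map Item.edge = H.map Rec.edge := by
    rw [hS, List.map_map]; rfl
  refine ⟨(3, H.length, 0), by simp [LexLt], H, { hC with flag_supp := ?_ }, rfl, [], H, [], rfl,
    hS, rfl, ⟨hU.maxDeg, hU.color⟩, Unwound.start ?_, rfl⟩
  · intro e he
    simp only [Mem.startUnwind, hmap] at he
    by_contra hcon
    simp [hcon] at he
  · intro h hh
    simp only [Mem.startUnwind, hmap]
    rw [if_pos (List.mem_map_of_mem hh)]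

lemma Core.split_nodup {H₁ H₂ : List (Rec n k)} (hC : Core G w δ rest (H₁ ++ H₂) m) :
    (H₂.map Rec.edge).Nodup := by
  have := hC.nodup
  rw [List.map_append] at this
  exact (List.nodup_append.1 this).2.1

lemma Inv.step_post (hδ : 0 < δ) (hI : Inv G w δ ([], m) t) (h : PostStep m m') :
    ∃ t', LexLt t' t ∧ Inv G w δ ([], m') t' := by
  obtain ⟨H, hC, hP⟩ := hI
  cases h with
  | popTake a S hp hS ha =>
    simp only [hp] at hP
    obtain ⟨-, H₁, H₂, Fr, rfl, hS', hF, hU, hUn, rfl⟩ := hP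
    rw [hS'] at hS
    obtain ⟨f, H₂, rfl, rfl, rfl⟩ := List.map_eq_cons_iff.1 hS
    refine ⟨_, ?_, H₁ ++ f :: H₂, hC.congr rfl rfl rfl, rfl, H₁, f, H₂, Fr, m.flag,
      queue (f :: H₂) f.a.u f.i, rfl, rfl, rfl, by simp [hF], ⟨hU.maxDeg, hU.color⟩, hUn, ha,
      hUn.chased, ?_, Or.inl ⟨rfl, List.suffix_refl _, ?_, rfl⟩⟩
    · simp [LexLt]
    · rw [queue_cons, if_pos f.inQ_u]; rfl
    · intro h hh _ hq
      exact mem_queue.2 ⟨List.mem_cons_of_mem _ hh, hq⟩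
  | popDrop a S hp hS ha =>
    simp only [hp] at hP
    obtain ⟨-, H₁, H₂, Fr, rfl, hS', hF, hU, hUn, rfl⟩ := hP
    rw [hS'] at hS
    obtain ⟨f, H₂, rfl, rfl, rfl⟩ := List.map_eq_cons_iff.1 hS
    refine ⟨(3, H₂.length, 0), by simp [LexLt], H₁ ++ f :: H₂, hC.congr rfl rfl rfl, ?_⟩
    simp only [hp]
    exact ⟨rfl, H₁ ++ [f], H₂, Fr, by simp, rfl, hF, ⟨hU.maxDeg, hU.color⟩, hUn.drop ha, rfl⟩
  | chaseStep a x c hp =>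
    simp only [hp] at hP
    obtain ⟨-, H₁, f, H₂, Fr, flag₀, R, rfl, rfl, hS, hF, hU, hUn, hf, hCh, hR, hcase⟩ := hP
    obtain ⟨r, R, rfl, rfl⟩ : ∃ r R', R = r :: R' ∧ c = r.edge := by
      cases R with
      | nil => simp [top] at hR
      | cons r R => exact ⟨r, R, rfl, by simpa [top] using hR⟩
    have hnd := hC.split_nodup
    have hmem : ∀ {y q}, (r :: R) <:+ queue (f :: H₂) y q → r ∈ f :: H₂ ∧ r.InQ y q :=
      fun hs => mem_queue.1 (hs.subset List.mem_cons_self)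
    have hr : r ∈ f :: H₂ ∧ (r.InQ f.a.u f.i ∨ r.InQ f.a.v f.j) := by
      rcases hcase with h | h
      · exact ⟨(hmem h.2.1).1, Or.inl (hmem h.2.1).2⟩
      · exact ⟨(hmem h.2.1).1, Or.inr (hmem h.2.1).2⟩
    have hCh' := hCh.step hnd hr.1 hr.2
    have hne : ∀ h, Function.update m.flag r.edge (some false) h.edge = some true →
        m.flag h.edge = some true ∧ h ≠ r := by
      intro h hh
      by_cases he : h.edge = r.edge
      · rw [he, Function.update_self] at hh; simp at hh
      · rw [Function.update_of_ne he] at hh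
        exact ⟨hh, fun h' => he (h' ▸ rfl)⟩
    have hC' : Core G w δ [] (H₁ ++ f :: H₂) { m with
        flag := Function.update m.flag r.edge (some false)
        phase := Phase.chase f.a x (m.p x r.edge) } :=
      { hC with
        flag_supp := by
          intro e he
          by_cases h' : e = r.edge
          · subst h'
            exact List.mem_map_of_mem (List.mem_append_right _ hr.1)
          · simp only [Function.update_of_ne h'] at he
            exact hC.flag_supp e he }
    have hp' := hC.ptr.append_right
    rcases hcase with ⟨rfl, hs, hall, rfl⟩ | ⟨rfl, hs, hall, rfl⟩
    · refine ⟨_, ?_, H₁ ++ f :: H₂, hC', rfl, H₁, f, H₂, Fr, flag₀, R, rfl, rfl, hS, hF,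
        ⟨hU.maxDeg, hU.color⟩, hUn, hf, hCh', hp'.next hs,
        Or.inl ⟨rfl, (List.suffix_cons r R).trans hs, ?_, rfl⟩⟩
      · simp [LexLt]
      · intro h hh ht hq
        obtain ⟨h1, h2⟩ := hne h ht
        exact (List.mem_cons.1 (hall h hh h1 hq)).resolve_left h2
    · refine ⟨_, ?_, H₁ ++ f :: H₂, hC', rfl, H₁, f, H₂, Fr, flag₀, R, rfl, rfl, hS, hF,
        ⟨hU.maxDeg, hU.color⟩, hUn, hf, hCh', hp'.next hs,
        Or.inr ⟨rfl, (List.suffix_cons r R).trans hs, ?_, rfl⟩⟩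
      · simp [LexLt]
      · intro h hh ht
        obtain ⟨h1, h2⟩ := hne h ht
        obtain ⟨h3, h4⟩ := hall h hh h1
        exact ⟨h3, fun hq => (List.mem_cons.1 (h4 hq)).resolve_left h2⟩
  | chaseNext a hp =>
    simp only [hp] at hP
    obtain ⟨-, H₁, f, H₂, Fr, flag₀, R, rfl, rfl, hS, hF, hU, hUn, hf, hCh, hR, hcase⟩ := hP
    obtain rfl : R = [] := by
      cases R with
      | nil => rfl
      | cons r R => simp [top] at hR
    have hfne : f.a.u ≠ f.a.v := hC.valid.ne (by simp)
    rcases hcase with ⟨-, hs, hall, rfl⟩ | ⟨h, -⟩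
    · refine ⟨_, ?_, H₁ ++ f :: H₂, hC.congr rfl rfl rfl, rfl, H₁, f, H₂, Fr, flag₀,
        queue (f :: H₂) f.a.v f.j, rfl, rfl, hS, hF,
        ⟨hU.maxDeg, hU.color⟩, hUn, hf, hCh, ?_,
        Or.inr ⟨rfl, List.suffix_refl _, ?_, rfl⟩⟩
      · have : (queue (f :: H₂) f.a.v f.j).length ≤ (f :: H₂).length := List.length_filter_le _ _
        simp [LexLt] at this ⊢
        omega
      · rw [queue_cons, if_pos f.inQ_v]; rfl
      · intro h hh ht
        exact ⟨fun hq => by simpa using hall h hh ht hq,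
          fun hq => mem_queue.2 ⟨List.mem_cons_of_mem _ hh, hq⟩⟩
    · exact absurd h hfne
  | chaseEnd a hp =>
    simp only [hp] at hP
    obtain ⟨-, H₁, f, H₂, Fr, flag₀, R, rfl, rfl, hS, hF, hU, hUn, hf, hCh, hR, hcase⟩ := hP
    obtain rfl : R = [] := by
      cases R with
      | nil => rfl
      | cons r R => simp [top] at hR
    have hfne : f.a.u ≠ f.a.v := hC.valid.ne (by simp)
    rcases hcase with ⟨h, -⟩ | ⟨-, hs, hall, rfl⟩
    · exact absurd h.symm hfne
    · refine ⟨_, ?_, H₁ ++ f :: H₂, hC.congr rfl rfl rfl, rfl, H₁ ++ [f], H₂, f :: Fr, by simp,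
        hS, hF, ⟨hU.maxDeg, hU.color⟩,
        hUn.take hδ hC.valid.append_right hf hCh (fun h hh ht => (hall h hh ht).1)
          (fun h hh ht hq => by simpa using (hall h hh ht).2 hq), rfl⟩
      simp [LexLt]
  | startColoring hp hS =>
    simp only [hp] at hP
    obtain ⟨-, H₁, H₂, Fr, rfl, hS', hF, hU, hUn, rfl⟩ := hP
    rw [hS'] at hS
    obtain rfl := List.map_eq_nil_iff.1 hS
    simp only [List.append_nil] at hC
    refine ⟨_, ?_, H₁, hC.congr rfl rfl rfl, rfl, hUn.taken hC hF rfl ?_ rfl, Proper.empty, rfl⟩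
    · simp [LexLt]
    · simpa using hS'
  | commonColor u v a hp he hc ha hu hv =>
    simp only [hp] at hP
    obtain ⟨-, hT, hPr, rfl⟩ := hP
    refine ⟨(2, uncolored (m.F.map Item.edge) (Function.update m.color s(u, v) (some a)),
      2 * n + 5), ?_, H, hC.congr rfl rfl rfl, ?_⟩
    · have := uncolored_lt (E := m.F.map Item.edge) (C := m.color)
        (C' := Function.update m.color s(u, v) (some a))
        (fun e h => by
          by_cases h' : e = s(u, v)
          · rw [h']; exact hc
          · rwa [Function.update_of_ne h'] at h) he hc (by simp)
      simp [LexLt, this]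
    · simp only [hp]
      exact ⟨rfl, hT.congr rfl rfl rfl, hPr.update he ha hu hv, rfl⟩
  | startFan u v hp he hc ha =>
    simp only [hp] at hP
    obtain ⟨-, hT, hPr, rfl⟩ := hP
    refine ⟨_, ?_, H, hC.congr rfl rfl rfl, rfl, hT.congr rfl rfl rfl, hPr,
      ⟨⟨v, [], rfl, hc⟩, by simpa using he, by simp, by simp⟩, rfl⟩
    simp [LexLt]; omega
  | extendFan u l z x a hp hz hx hc ha =>
    simp only [hp] at hP
    obtain ⟨-, hT, hPr, hFan, rfl⟩ := hP
    have hFan' := hFan.append hPr hz hx hc ha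
    refine ⟨_, ?_, H, hC.congr rfl rfl rfl, rfl, hT.congr rfl rfl rfl, hPr, hFan', rfl⟩
    have := hFan'.nodup.length_le_card
    simp [LexLt] at this ⊢
    omega
  | rotate u l z d hp hz hmax hd hdz hdu =>
    simp only [hp] at hP
    obtain ⟨-, hT, hPr, hFan, rfl⟩ := hP
    obtain ⟨h1, h2, h3⟩ := rotateFan_spec hPr hFan hz hd hdz hdu
    obtain ⟨v, l', rfl, hv⟩ := hFan.head
    refine ⟨_, ?_, H, hC.congr rfl rfl rfl, rfl, hT.congr rfl rfl rfl, h1, rfl⟩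
    have := uncolored_lt h2 (hFan.mem v (by simp)) hv (h3 v rfl)
    simp [LexLt, this]
  | startPath u l z c d hp hz hmax hc hcu hd hdz hdu =>
    simp only [hp] at hP
    obtain ⟨-, hT, hPr, hFan, rfl⟩ := hP
    refine ⟨_, ?_, H, hC.congr rfl rfl rfl, rfl, hT.congr rfl rfl rfl, m.color, [],
      PathInv.init hPr hFan hz hmax hc hcu hd hdz hdu, rfl⟩
    simp [LexLt]; omega
  | pathStep u l c d x z q y hp hy hq =>
    simp only [hp] at hP
    obtain ⟨-, hT, C₀, P, hPa, rfl⟩ := hP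
    have hPa' := hPa.step (hT.not_isDiag hC) hy hq
    refine ⟨_, ?_, H, hC.congr rfl rfl rfl, rfl, hT.congr rfl rfl rfl, C₀, x :: P, hPa', rfl⟩
    have h1 := hPa'.nodup.length_le_card
    have h2 : uncolored (m.F.map Item.edge) (Function.update m.color s(x, y)
        (some (if q = d then c else d))) = uncolored (m.F.map Item.edge) m.color := by
      unfold uncolored
      congr 1
      ext e
      simp only [Finset.mem_filter]
      rw [hPa.eq_none_iff e, ← hPa'.eq_none_iff e]
      rfl
    simp [LexLt, h2] at h1 ⊢
    omega
  | pathEnd u l c d x z q z' hp hmax hz' =>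
    simp only [hp] at hP
    obtain ⟨-, hT, C₀, P, hPa, rfl⟩ := hP
    obtain ⟨hPr, hdu, hFan, hfree⟩ := hPa.finish (hT.not_isDiag hC) hmax
    obtain ⟨h1, h2, h3⟩ := rotateFan_spec hPr hFan hz' hPa.hd (hfree z' hz') hdu
    obtain ⟨v, l', hl', hv⟩ := hFan.head
    refine ⟨_, ?_, H, hC.congr rfl rfl rfl, rfl, hT.congr rfl rfl rfl, h1, rfl⟩
    have := uncolored_lt h2 (hFan.mem v (by simp [hl'])) hv (h3 v (by simp [hl']))
    simp [LexLt, this]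
  | finish hp hc hk =>
    simp only [hp] at hP
    obtain ⟨-, hT, hPr, rfl⟩ := hP
    have hlt : m.maxDeg + 1 ≤ k := by
      have := hT.deg
      rw [← hT.maxDeg] at this
      omega
    refine ⟨_, ?_, H, hC.congr rfl rfl rfl, rfl, hT.congr rfl rfl rfl,
      ⟨hPr.supp, fun e a h => ?_, hPr.inj⟩, hc, ?_, rfl⟩
    · simp [LexLt]
    · have := hPr.col e a h
      simp at this ⊢
      omega
    -- Here at most k colors were available, so class k + 1 is empty and nothing is lost.
    · have h0 : classWeight m.F m.color (k + 1) = 0 := by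
        unfold classWeight
        rw [List.filter_eq_nil_iff.2]
        · simp
        · intro a _ h
          have := hPr.col a.edge (k + 1) (by simpa using h)
          simp at this
          omega
      rw [h0, mul_zero]
      refine List.sum_nonneg fun y hy => ?_
      obtain ⟨a, ha, rfl⟩ := List.mem_map.1 hy
      exact hT.wt_nonneg hC a ha
  | startSelect hp hc hk =>
    simp only [hp] at hP
    obtain ⟨-, hT, hPr, rfl⟩ := hP
    refine ⟨_, ?_, H, hC.congr rfl rfl rfl, rfl, hT.congr rfl rfl rfl, hPr, hc, ?_,
      ⟨[], rfl, fun c => by simp [classWeight]⟩, rfl⟩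
    · simp [LexLt]
    · simpa using hk
  | selectStep a l s c hp hc =>
    simp only [hp] at hP
    obtain ⟨-, hT, hPr, hall, hk, ⟨F₁, hF, hs⟩, rfl⟩ := hP
    refine ⟨_, ?_, H, hC.congr rfl rfl rfl, rfl, hT.congr rfl rfl rfl, hPr, hall, hk,
      ⟨F₁ ++ [a], by simp [hF], fun c' => ?_⟩, rfl⟩
    · simp [LexLt]
    · rw [classWeight_append]
      by_cases h : c' = c
      · subst h; simp [hs, classWeight, hc]
      · have h' : c ≠ c' := Ne.symm h
        rw [Function.update_of_ne h]
        simp [hs, classWeight, hc, h']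
  | selectEnd s c hp hc hmin =>
    simp only [hp] at hP
    obtain ⟨-, hT, hPr, hall, hk, ⟨F₁, hF, hs⟩, rfl⟩ := hP
    rw [List.append_nil] at hF
    subst hF
    rw [hk] at hPr
    refine ⟨_, ?_, H, hC.congr rfl rfl rfl, rfl, hT.congr rfl rfl rfl, hPr.exchange hc,
      ?_, ?_, rfl⟩
    · simp [LexLt]
    · intro a ha
      simpa using hall a ha
    · have h1 : classWeight m.F (fun e => (m.color e).map (Equiv.swap c (k + 1))) (k + 1)
          = classWeight m.F m.color c := by
        unfold classWeight
        congr 2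
        refine List.filter_congr fun a _ => ?_
        simp only [decide_eq_decide, Option.map_eq_some_iff]
        constructor
        · rintro ⟨b, hb, hb'⟩
          rw [Equiv.swap_apply_eq_iff, Equiv.swap_apply_right] at hb'
          rw [hb, hb']
        · intro h
          exact ⟨c, h, Equiv.swap_apply_left _ _⟩
      have h2 : ∑ c ∈ Finset.Icc 1 (k + 1), classWeight m.F m.color c = (m.F.map Item.wt).sum := by
        refine sum_classWeight fun a ha => ?_
        obtain ⟨b, hb⟩ := Option.ne_none_iff_exists'.1 (hall a ha)
        exact ⟨b, hPr.col _ _ hb, hb⟩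
      -- The lightest of k + 1 classes weighs at most their average.
      have h3 := Finset.card_nsmul_le_sum (Finset.Icc 1 (k + 1))
        (fun c => classWeight m.F m.color c) (classWeight m.F m.color c) fun c' hc' => by
          rw [← hs, ← hs]; exact hmin c' hc'
      dsimp only
      rw [h1, ← h2]
      simpa using h3

lemma Inv.step {c c' : Config n k} (hδ : 0 < δ) (hε : ε / 2 = 2 * δ)
    (hw : ∀ e ∈ G.edgeSet, 0 < w e)
    (hI : Inv G w δ c t) (h : Step ε c c') : ∃ t', LexLt t' t ∧ Inv G w δ c' t' := by
  cases h with
  | read a l m m' hp h => exact hI.step_read hδ hw hp (hε ▸ h)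
  | endOfStream m hp => exact hI.step_end hp
  | post m m' h => exact hI.step_post hδ h

end

section
variable {n k : ℕ} {G : SimpleGraph (Fin n)} {w : Sym2 (Fin n) → ℝ} {δ ε : ℝ}
  {rest l : List (Item n)} {H : List (Rec n k)} {m m' : Mem n k} {t : ℕ × ℕ × ℕ}

/-! ### Termination -/

/-- No phase can get stuck: flags of stacked edges are defined, every vertex has a free color
because there are more colors than its degree, and every fan or path either extends or is maximal.
-/
lemma exists_postStep (hC : Core G w δ rest H m) (hP : PhaseInv G w rest H m t m.phase)
    (hs : m.phase ≠ Phase.stream) (hh : m.phase ≠ Phase.halt) : ∃ m', PostStep m m' := by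
  cases hp : m.phase with
  | stream => exact absurd hp hs
  | halt => exact absurd hp hh
  | unwind =>
    simp only [hp] at hP
    obtain ⟨-, H₁, H₂, Fr, rfl, hS, hF, hU, hUn, rfl⟩ := hP
    cases H₂ with
    | nil => exact ⟨_, .startColoring hp hS⟩
    | cons f H₂ =>
      rcases hUn.flagged f List.mem_cons_self with hf | hf
      · exact ⟨_, .popTake f.a _ hp hS hf⟩
      · exact ⟨_, .popDrop f.a _ hp hS hf⟩
  | chase a x cp =>
    simp only [hp] at hP
    obtain ⟨-, H₁, f, H₂, Fr, flag₀, R, rfl, rfl, hS, hF, hU, hUn, hf, hCh, hR, hcase⟩ := hP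
    cases cp with
    | some c => exact ⟨_, .chaseStep _ _ _ hp⟩
    | none =>
      rcases hcase with ⟨rfl, -⟩ | ⟨rfl, -⟩
      · exact ⟨_, .chaseNext _ hp⟩
      · exact ⟨_, .chaseEnd _ hp⟩
  | coloring =>
    simp only [hp] at hP
    obtain ⟨-, hT, hPr, rfl⟩ := hP
    by_cases hall : ∀ a ∈ m.F, m.color a.edge ≠ none
    · by_cases hk : m.maxDeg + 1 = k + 1
      · exact ⟨_, .startSelect hp hall hk⟩
      · exact ⟨_, .finish hp hall hk⟩
    · push Not at hall
      obtain ⟨a, ha, hc⟩ := hall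
      have he : s(a.u, a.v) ∈ m.F.map Item.edge := List.mem_map_of_mem ha
      by_cases hcom : ∃ b ∈ Finset.Icc 1 (m.maxDeg + 1), Free m.color a.u b ∧ Free m.color a.v b
      · obtain ⟨b, hb, hu, hv⟩ := hcom
        exact ⟨_, .commonColor a.u a.v b hp he hc hb hu hv⟩
      · exact ⟨_, .startFan a.u a.v hp he hc fun b hb h => hcom ⟨b, hb, h⟩⟩
  | fan u l =>
    simp only [hp] at hP
    obtain ⟨-, hT, hPr, hFan, rfl⟩ := hP
    obtain ⟨z, hz⟩ : ∃ z, l.getLast? = some z := by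
      obtain ⟨v, l', rfl, -⟩ := hFan.head
      exact ⟨_, List.getLast?_eq_some_getLast (by simp)⟩
    by_cases hmax : ∀ x a, x ∉ l → m.color s(u, x) = some a → ¬ Free m.color z a
    · obtain ⟨d, hd, hdz⟩ := hPr.exists_free (hT.degree z)
      by_cases hdu : Free m.color u d
      · exact ⟨_, .rotate u l z d hp hz hmax hd hdz hdu⟩
      · obtain ⟨c, hc, hcu⟩ := hPr.exists_free (hT.degree u)
        exact ⟨_, .startPath u l z c d hp hz hmax hc hcu hd hdz hdu⟩
    · push Not at hmax
      obtain ⟨x, a, hx, hc, ha⟩ := hmax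
      exact ⟨_, .extendFan u l z x a hp hz hx hc ha⟩
  | path u l c d x z q =>
    simp only [hp] at hP
    obtain ⟨-, hT, C₀, P, hPa, rfl⟩ := hP
    by_cases hnext : ∃ y, z ≠ some y ∧ m.color s(x, y) = some q
    · obtain ⟨y, hy, hq⟩ := hnext
      exact ⟨_, .pathStep u l c d x z q y hp hy hq⟩
    · push Not at hnext
      have hne : l ≠ [] := by
        obtain ⟨v, l', rfl, -⟩ := hPa.fan₀.head
        simp
      exact ⟨_, .pathEnd u l c d x z q _ hp hnext
        (List.getLast?_eq_some_getLast (shrinkFan_ne_nil m.color d hne))⟩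
  | select l s =>
    simp only [hp] at hP
    obtain ⟨-, hT, hPr, hall, hk, ⟨F₁, hF, hs⟩, rfl⟩ := hP
    cases l with
    | nil =>
      obtain ⟨c, hc, hmin⟩ := Finset.exists_min_image (Finset.Icc 1 (k + 1)) s ⟨1, by simp⟩
      exact ⟨_, .selectEnd s c hp hc hmin⟩
    | cons a l =>
      obtain ⟨c, hc⟩ := Option.ne_none_iff_exists'.1 (hall a (by simp [hF]))
      exact ⟨_, .selectStep a l s c hp hc⟩

lemma Inv.exists_step {c : Config n k} (hk : 1 ≤ k) (hI : Inv G w δ c t)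
    (hh : c.2.phase ≠ Phase.halt) : ∃ c', Step ε c c' := by
  obtain ⟨l, m⟩ := c
  obtain ⟨H, hC, hP⟩ := hI
  by_cases hs : m.phase = Phase.stream
  · cases l with
    | nil => exact ⟨_, .endOfStream m hs⟩
    | cons a l =>
      have : Nonempty (Fin k) := ⟨⟨0, hk⟩⟩
      obtain ⟨i, hi⟩ := Finite.exists_min (m.phi a.u)
      obtain ⟨j, hj⟩ := Finite.exists_min (m.phi a.v)
      rcases le_or_gt ((1 + ε / 2 / 2) * (m.phi a.u i + m.phi a.v j)) a.wt with h | h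
      · exact ⟨_, .read a l m _ hs (.push i j hi hj h)⟩
      · exact ⟨_, .read a l m _ hs (.skip i j hi hj h)⟩
  · obtain ⟨m', h⟩ := exists_postStep hC hP hs hh
    obtain rfl : l = [] := by
      cases hp : m.phase <;> simp only [hp] at hP
      · exact absurd hp hs
      all_goals exact hP.1
    exact ⟨_, .post m m' h⟩

lemma Reaches.inv {c : Config n k} (hδ : 0 < δ) (hε : ε / 2 = 2 * δ)
    (hw : ∀ e ∈ G.edgeSet, 0 < w e) (hl : IsStream G w l) (hc : Reaches ε l c) :
    ∃ t, Inv G w δ c t := by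
  induction hc with
  | refl => exact inv_init hl
  | tail _ h ih =>
    obtain ⟨t, ht⟩ := ih
    obtain ⟨t', -, ht'⟩ := ht.step hδ hε hw h
    exact ⟨t', ht'⟩

lemma Inv.not_infinite (hδ : 0 < δ) (hε : ε / 2 = 2 * δ)
    (hw : ∀ e ∈ G.edgeSet, 0 < w e) (t : ℕ × ℕ × ℕ) :
    ∀ c : Config n k, Inv G w δ c t →
      ¬ ∃ f : ℕ → Config n k, f 0 = c ∧ ∀ i, Step ε (f i) (f (i + 1)) := by
  induction t using lexLt_wf.induction with
  | h t ih =>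
    rintro c hI ⟨f, rfl, hf⟩
    obtain ⟨t', hlt, hI'⟩ := hI.step hδ hε hw (hf 0)
    exact ih t' hlt _ hI' ⟨fun i => f (i + 1), rfl, fun i => hf (i + 1)⟩

lemma alwaysHalts (hδ : 0 < δ) (hε : ε / 2 = 2 * δ) (hk : 1 ≤ k)
    (hw : ∀ e ∈ G.edgeSet, 0 < w e) (hl : IsStream G w l) : AlwaysHalts k ε l := by
  constructor
  · obtain ⟨t, ht⟩ := inv_init (k := k) (δ := δ) hl
    exact Inv.not_infinite hδ hε hw t _ ht
  · intro c hc hstuck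
    obtain ⟨t, ht⟩ := hc.inv hδ hε hw hl
    by_contra hh
    exact hstuck (ht.exists_step hk hh)

/-! ### The approximation ratio -/

/-- Each matching has at most one edge at a vertex, so the union has degrees at most k; disjointness
makes its weight that of the family. -/
lemma IsDisjointMatching.weight_le {M : Fin k → Finset (Sym2 (Fin n))}
    (hM : IsDisjointMatching G M) (hδ : 0 < δ) (hk : 1 ≤ k) (hC : Core G w δ [] H m) :
    weight w M ≤ 2 * (1 + δ) * (H.map Rec.g).sum := by
  obtain ⟨hG, hmat, hdis⟩ := hM
  have h1 : weight w M = ∑ e ∈ Finset.univ.biUnion M, w e :=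
    (Finset.sum_biUnion fun i _ j _ hij => hdis i j hij).symm
  rw [h1]
  refine (weight_le_sum_level hδ hk hC.valid hC.nodup hC.wt ?_ ?_).trans (le_of_eq ?_)
  · intro x
    rw [Finset.filter_biUnion]
    refine Finset.card_biUnion_le.trans ?_
    refine (Finset.sum_le_card_nsmul _ _ 1 fun i _ => ?_).trans (by simp)
    rw [Finset.card_le_one]
    intro e he f hf
    rw [Finset.mem_filter] at he hf
    by_contra hne
    exact hmat i e he.1 f hf.1 hne x he.2 hf.2
  · intro e he
    obtain ⟨i, -, hi⟩ := Finset.mem_biUnion.1 he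
    simpa using hC.cover e (hG i e hi)
  · rw [hC.valid.sum_level]; ring

lemma Core.item_edge (hC : Core G w δ rest H m) (hsub : ∀ a ∈ m.F, ∃ h ∈ H, h.a = a) :
    ∀ a ∈ m.F, a.edge ∈ G.edgeSet ∧ a.wt = w a.edge := by
  intro a ha
  obtain ⟨h, hh, rfl⟩ := hsub a ha
  exact ⟨hC.mem h hh, hC.wt h hh⟩

/-- Combines optimum ≤ 2(1 + δ) · gains, gains ≤ w(F), and the loss of at most a fraction 1/(k + 1)
of w(F) with class k + 1. -/
lemma Inv.isApprox {c : Config n k} (hδ : 0 < δ) (hk : 1 ≤ k) (hI : Inv G w δ c t)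
    (hh : c.2.phase = Phase.halt) :
    IsApprox (1 / (2 * (1 + δ)) * (1 - 1 / ((k : ℝ) + 1))) G w c.2.output := by
  obtain ⟨l, m⟩ := c
  obtain ⟨H, hC, hP⟩ := hI
  dsimp only at hh hC hP ⊢
  simp only [hh] at hP
  obtain ⟨rfl, hT, hPr, hall, hlast, -⟩ := hP
  have hF := hC.item_edge hT.sub
  have hout : ∀ i e, e ∈ m.output i ↔
      e ∈ m.F.map Item.edge ∧ m.color e = some (i.val + 1) := by
    intro i e
    simp [Mem.output]
  constructor
  · refine ⟨fun i e he => ?_, fun i e he f hf hne v hve hvf => ?_, fun i j hij => ?_⟩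
    · obtain ⟨a, ha, rfl⟩ := List.mem_map.1 ((hout i e).1 he).1
      exact (hF a ha).1
    · obtain ⟨y, rfl⟩ := Sym2.mem_iff_exists.1 hve
      obtain ⟨y', rfl⟩ := Sym2.mem_iff_exists.1 hvf
      exact hne (by rw [hPr.inj v y y' _ ((hout i _).1 he).2 ((hout i _).1 hf).2])
    · rw [Finset.disjoint_left]
      intro e he hf
      have := ((hout i e).1 he).2.symm.trans ((hout j e).1 hf).2
      simp only [Option.some.injEq, Nat.add_right_cancel_iff] at this
      exact hij (Fin.ext this)
  · intro M' hM'
    have h1 : ∀ i : Fin k, ∑ e ∈ m.output i, w e = classWeight m.F m.color (i.val + 1) := by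
      intro i
      have hL : m.output i = ((m.F.map Item.edge).filter fun e =>
          m.color e = some (i.val + 1)).toFinset := by
        ext e; simp [hout]
      rw [hL, List.sum_toFinset _ (hT.nodup.filter _), List.filter_map, List.map_map, classWeight]
      refine congrArg List.sum (List.map_congr_left fun a ha => ?_)
      exact (hF a (List.mem_filter.1 ha).1).2.symm
    have h2 : weight w m.output = ∑ i ∈ Finset.range k, classWeight m.F m.color (i + 1) := by
      rw [weight, Finset.sum_range]
      exact Finset.sum_congr rfl fun i _ => h1 i
    have h3 : ∑ i ∈ Finset.range (k + 1), classWeight m.F m.color (i + 1)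
        = (m.F.map Item.wt).sum := by
      rw [← sum_classWeight (F := m.F) (C := m.color) (S := (Finset.range (k + 1)).image (· + 1)),
        Finset.sum_image (by simp)]
      intro a ha
      obtain ⟨b, hb⟩ := Option.ne_none_iff_exists'.1 (hall a ha)
      have := hPr.col _ _ hb
      rw [Finset.mem_Icc] at this
      refine ⟨b, Finset.mem_image.2 ⟨b - 1, ?_, ?_⟩, hb⟩
      · rw [Finset.mem_range]; omega
      · omega
    rw [Finset.sum_range_succ, ← h2] at h3
    have h4 := hM'.weight_le hδ hk hC
    have h5 := hT.wt
    have hk0 : (0 : ℝ) < (k : ℝ) + 1 := by positivity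
    have h6 : classWeight m.F m.color (k + 1) ≤ (m.F.map Item.wt).sum / ((k : ℝ) + 1) := by
      rw [le_div_iff₀ hk0]; linarith
    have h7 : (0 : ℝ) ≤ 1 - 1 / ((k : ℝ) + 1) := by
      rw [sub_nonneg, div_le_one hk0]
      have : (0 : ℝ) ≤ k := by positivity
      linarith
    calc 1 / (2 * (1 + δ)) * (1 - 1 / ((k : ℝ) + 1)) * weight w M'
        ≤ 1 / (2 * (1 + δ)) * (1 - 1 / ((k : ℝ) + 1)) * (2 * (1 + δ) * (H.map Rec.g).sum) := by
          gcongr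
      _ = (1 - 1 / ((k : ℝ) + 1)) * (H.map Rec.g).sum := by field_simp
      _ ≤ (1 - 1 / ((k : ℝ) + 1)) * (m.F.map Item.wt).sum := by gcongr
      _ = (m.F.map Item.wt).sum - (m.F.map Item.wt).sum / ((k : ℝ) + 1) := by ring
      _ ≤ weight w m.output := by linarith

lemma IsApprox.mono {α β : ℝ} (hαβ : α ≤ β) (hw : ∀ e ∈ G.edgeSet, 0 < w e)
    {M : Fin k → Finset (Sym2 (Fin n))} (hM : IsApprox β G w M) : IsApprox α G w M := by
  refine ⟨hM.1, fun M' hM' => le_trans ?_ (hM.2 M' hM')⟩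
  have : 0 ≤ weight w M' :=
    Finset.sum_nonneg fun i _ => Finset.sum_nonneg fun e he => (hw e (hM'.1 i e he)).le
  gcongr

/-! ### Space -/

lemma dictSize_le {α β : Type} [Fintype α] {f : α → Option β} {L : List α}
    (h : ∀ x, f x ≠ none → x ∈ L) : dictSize f ≤ L.length := by
  classical
  refine le_trans (Finset.card_le_card (t := L.toFinset) fun x hx => ?_) (List.toFinset_card_le L)
  simp only [Finset.mem_filter, Finset.mem_univ, true_and] at hx
  exact List.mem_toFinset.2 (h x (Option.isSome_iff_ne_none.1 hx))

/-- An edge shares its queues with itself, so pairwise disjoint queues exclude repetitions. -/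
lemma Unwound.length_le {H₁ H₂ Fr : List (Rec n k)} {flag : Sym2 (Fin n) → Option Bool}
    (hU : Unwound H₁ H₂ Fr flag) : Fr.length ≤ H₁.length := by
  have hnd : Fr.Nodup := by
    refine hU.pair.imp fun {f f'} hff he => ?_
    exact hff _ _ f.inQ_u (he ▸ f.inQ_u)
  exact (hnd.subperm hU.sub).length_le

lemma Taken.length_le (hT : Taken H m) : m.F.length ≤ H.length := by
  have h1 : (m.F.map Item.edge).Subperm (H.map Rec.edge) := by
    refine hT.nodup.subperm fun e he => ?_
    obtain ⟨a, ha, rfl⟩ := List.mem_map.1 he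
    obtain ⟨h, hh, rfl⟩ := hT.sub a ha
    exact List.mem_map_of_mem hh
  simpa using h1.length_le

lemma Taken.maxDeg_lt (hn : 0 < n) (hC : Core G w δ rest H m) (hT : Taken H m) :
    m.maxDeg + 1 ≤ n := by
  have : maxDegree m.F ≤ n - 1 := maxDegree_le_iff.2 fun x =>
    Nat.le_sub_one_of_lt (degree_lt_of_nodup hT.nodup (hT.not_isDiag hC) x)
  rw [hT.maxDeg]
  omega

/-- Bounds for the sizes of the variables. -/
structure Small (H : List (Rec n k)) (m : Mem n k) : Prop where
  stack : ∀ a ∈ m.stack, ∃ h ∈ H, h.a = a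
  stack_le : m.stack.length ≤ H.length
  sub : ∀ a ∈ m.F, ∃ h ∈ H, h.a = a
  length_le : m.F.length ≤ H.length
  color : ∀ e, m.color e ≠ none → e ∈ m.F.map Item.edge
  maxDeg : 0 < n → m.maxDeg + 1 ≤ n

lemma Taken.small (hC : Core G w δ rest H m) (hT : Taken H m)
    (hc : ∀ e, m.color e ≠ none → e ∈ m.F.map Item.edge) : Small H m where
  stack := by simp [hT.stack]
  stack_le := by simp [hT.stack]
  sub := hT.sub
  length_le := hT.length_le
  color := hc
  maxDeg := fun hn => hT.maxDeg_lt hn hC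

lemma small_of_unwinding {H₁ H₂ Fr : List (Rec n k)} (h₁ : ∀ h ∈ H₁, h ∈ H)
    (h₂ : ∀ h ∈ H₂, h ∈ H) (hlen₁ : Fr.length ≤ H.length) (hlen₂ : H₂.length ≤ H.length)
    (hFr : ∀ f ∈ Fr, f ∈ H₁) (hS : m.stack = H₂.map Rec.a) (hF : m.F = Fr.map Rec.a)
    (hU : Unstarted m) : Small H m where
  stack := by
    rw [hS]; intro a ha
    obtain ⟨h, hh, rfl⟩ := List.mem_map.1 ha
    exact ⟨h, h₂ h hh, rfl⟩
  stack_le := by simpa [hS]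
  sub := by
    rw [hF]; intro a ha
    obtain ⟨h, hh, rfl⟩ := List.mem_map.1 ha
    exact ⟨h, h₁ h (hFr h hh), rfl⟩
  length_le := by simpa [hF]
  color := fun e he => absurd (hU.color e) he
  maxDeg := fun hn => by rw [hU.maxDeg]; omega

lemma PhaseInv.small (hC : Core G w δ rest H m) (hP : PhaseInv G w rest H m t m.phase) :
    Small H m := by
  cases hp : m.phase <;> simp only [hp] at hP
  case stream =>
    obtain ⟨-, -, hS, hF, hU, -⟩ := hP
    exact small_of_unwinding (H₁ := []) (H₂ := H) (Fr := []) (by simp) (by simp) (by simp) le_rfl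
      (by simp) hS hF hU
  case unwind =>
    obtain ⟨-, H₁, H₂, Fr, rfl, hS, hF, hU, hUn, -⟩ := hP
    have := hUn.length_le
    exact small_of_unwinding (fun h => List.mem_append_left _) (fun h => List.mem_append_right _)
      (by simp; omega) (by simp) hUn.sub hS hF hU
  case chase =>
    obtain ⟨-, H₁, f, H₂, Fr, flag₀, R, rfl, rfl, hS, hF, hU, hUn, -⟩ := hP
    have := hUn.length_le
    refine small_of_unwinding (H₁ := H₁ ++ [f]) (H₂ := H₂) (Fr := f :: Fr)
      (fun h hh => ?_) (fun h hh => by simp [hh])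
      (by simp; omega) (by simp; omega) (fun f' hf' => ?_) hS hF hU
    · simp at hh ⊢; tauto
    · rcases List.mem_cons.1 hf' with rfl | hf'
      · simp
      · exact List.mem_append_left _ (hUn.sub f' hf')
  case coloring => exact hP.2.1.small hC hP.2.2.1.supp
  case fan => exact hP.2.1.small hC hP.2.2.1.supp
  case path =>
    obtain ⟨-, hT, C₀, P, hPa, -⟩ := hP
    exact hT.small hC fun e => hPa.supp
  case select => exact hP.2.1.small hC hP.2.2.1.supp
  case halt => exact hP.2.1.small hC hP.2.2.1.supp

lemma PhaseInv.bits_le (B : ℕ) (hk : 1 ≤ k) (hn : 0 < n) (hC : Core G w δ rest H m)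
    (hP : PhaseInv G w rest H m t m.phase) :
    m.phase.bits B m.maxDeg ≤ 10 * ((n * k + H.length) * (Nat.size n + B + 1)) := by
  have hS := hP.small hC
  have hD := hS.maxDeg hn
  have hlen := hS.length_le
  have hsz : Nat.size (m.maxDeg + 1) ≤ Nat.size n := Nat.size_le_size hD
  have hnk : n ≤ n * k := Nat.le_mul_of_pos_right n hk
  have hfan : ∀ l : List (Fin n), l.Nodup →
      (1 + l.length) * Nat.size n ≤ 2 * ((n * k + H.length) * (Nat.size n + B + 1)) := by
    intro l hl
    have h1 : l.length ≤ n := by simpa using hl.length_le_card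
    calc (1 + l.length) * Nat.size n ≤ (2 * (n * k + H.length)) * (Nat.size n + B + 1) :=
          Nat.mul_le_mul (by omega) (by omega)
      _ = _ := by ring
  have hX : Nat.size n + B + 1 ≤ (n * k + H.length) * (Nat.size n + B + 1) :=
    Nat.le_mul_of_pos_left _ (by omega)
  cases hp : m.phase <;> simp only [hp] at hP <;> simp only [Phase.bits]
  case fan u l =>
    have := hfan _ hP.2.2.2.1.nodup
    omega
  case path =>
    obtain ⟨-, hT, C₀, P, hPa, -⟩ := hP
    have := hfan _ hPa.fan₀.nodup
    omega
  case select l s =>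
    obtain ⟨-, hT, -, -, -, ⟨F₁, hF, -⟩, -⟩ := hP
    have h1 : l.length ≤ H.length := by
      rw [hF, List.length_append] at hlen; omega
    have h2 : l.length * (2 * Nat.size n + B) ≤ H.length * (2 * (Nat.size n + B + 1)) :=
      Nat.mul_le_mul h1 (by omega)
    have h3 : (m.maxDeg + 1) * (B + Nat.size n) ≤ (n * k) * (Nat.size n + B + 1) :=
      Nat.mul_le_mul (by omega) (by omega)
    nlinarith
  all_goals omega

/-- Every table has O(nk) entries or O(1) entries per pushed edge, and every entry has O(log n + B)
bits. The constant 100 is generous. -/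
lemma PhaseInv.mem_bits_le (B : ℕ) (hk : 1 ≤ k) (hn : 0 < n) (hC : Core G w δ rest H m)
    (hP : PhaseInv G w rest H m t m.phase) :
    m.bits B ≤ 100 * ((n * k + H.length) * (Nat.size n + B + 1)) := by
  have hS := hP.small hC
  have hD := hS.maxDeg hn
  have hsz : Nat.size (m.maxDeg + 1) ≤ Nat.size n := Nat.size_le_size hD
  have hsz' : Nat.size m.maxDeg ≤ Nat.size n := Nat.size_le_size (by omega)
  have hnk : n ≤ n * k := Nat.le_mul_of_pos_right n hk
  -- The parameter k is not bounded in terms of n; its length is absorbed by the factor k of the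
  -- bound instead.
  have hk' : Nat.size k ≤ n * k :=
    (Nat.size_le.2 Nat.lt_two_pow_self).trans (Nat.le_mul_of_pos_left k hn)
  have hb := hP.bits_le B hk hn hC
  have hp : dictSize (fun xe : Fin n × Sym2 (Fin n) => m.p xe.1 xe.2) ≤ 2 * H.length := by
    refine (dictSize_le (L := (H.map fun h => (h.a.u, h.edge)) ++ H.map fun h => (h.a.v, h.edge))
      ?_).trans (by simp; omega)
    rintro ⟨x, e⟩ hxe
    obtain ⟨h, hh, rfl, hx⟩ := hC.ptr_supp x e hxe
    have hx' : x = h.a.u ∨ x = h.a.v := by simpa [Rec.edge, Item.edge] using hx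
    rcases hx' with rfl | rfl
    · exact List.mem_append_left _ (List.mem_map.2 ⟨h, hh, rfl⟩)
    · exact List.mem_append_right _ (List.mem_map.2 ⟨h, hh, rfl⟩)
  have hf : dictSize m.flag ≤ H.length := by
    simpa using dictSize_le hC.flag_supp
  have hc : dictSize m.color ≤ H.length := by
    have := dictSize_le hS.color
    rw [List.length_map] at this
    exact this.trans hS.length_le
  have hst := hS.stack_le
  have hFl := hS.length_le
  unfold Mem.bits
  set N := H.length
  set s := Nat.size n
  set X := s + B + 1 with hX
  have e1 : n * k * B ≤ n * k * X := Nat.mul_le_mul_left _ (by omega)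
  have e2 : n * k * (1 + 2 * s) ≤ n * k * (2 * X) := Nat.mul_le_mul_left _ (by omega)
  have e3 := Nat.mul_le_mul hp (show 3 * s + 2 * s ≤ 5 * X by omega)
  have e4 := Nat.mul_le_mul hst (show 2 * s + B ≤ 2 * X by omega)
  have e5 := Nat.mul_le_mul hf (show 2 * s + 1 ≤ 2 * X by omega)
  have e6 := Nat.mul_le_mul hFl (show 2 * s + B ≤ 2 * X by omega)
  have e7 := Nat.mul_le_mul hc (show 2 * s + Nat.size (m.maxDeg + 1) ≤ 3 * X by omega)
  have e8 : X ≤ n * k * X := Nat.le_mul_of_pos_left _ (by omega)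
  have e9 : n * k ≤ n * k * X := Nat.le_mul_of_pos_right _ (by omega)
  have e10 : (n * k + N) * X = n * k * X + N * X := by ring
  have e11 : n * k * (2 * X) = 2 * (n * k * X) := by ring
  have e12 : 2 * N * (5 * X) = 10 * (N * X) := by ring
  have e13 : N * (2 * X) = 2 * (N * X) := by ring
  have e14 : N * (3 * X) = 3 * (N * X) := by ring
  omega

lemma size_le_logb (hn : 2 ≤ n) : (Nat.size n : ℝ) ≤ 2 * Real.logb 2 n ∧ 1 ≤ Real.logb 2 n := by
  have h1 : Nat.size n ≤ Nat.log 2 n + 1 := Nat.size_le.2 (Nat.lt_pow_succ_log_self one_lt_two n)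
  have h2 : ((Nat.log 2 n : ℕ) : ℝ) ≤ Real.logb 2 n := Real.natLog_le_logb n 2
  have h3 : (1 : ℝ) ≤ Real.logb 2 n := by
    have h4 : 1 ≤ Nat.log 2 n := Nat.log_pos one_lt_two hn
    exact le_trans (by exact_mod_cast h4) h2
  have h5 : (Nat.size n : ℝ) ≤ (Nat.log 2 n : ℕ) + 1 := by exact_mod_cast h1
  exact ⟨by linarith, h3⟩

lemma exists_space_bound (hδ : 0 < δ) (r : ℕ) : ∃ K : ℝ, ∀ (n k : ℕ), 2 ≤ n → 1 ≤ k →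
    ∀ (G : SimpleGraph (Fin n)) (w : Sym2 (Fin n) → ℝ),
    (∀ e ∈ G.edgeSet, ∀ f ∈ G.edgeSet, w e ≤ (n : ℝ) ^ r * w f) →
    ∀ B : ℕ, (B : ℝ) ≤ r * Real.logb 2 n → ∀ (c : Config n k) (t : ℕ × ℕ × ℕ), Inv G w δ c t →
    (c.2.bits B : ℝ) ≤ K * (n * k * Real.logb 2 n ^ 2) := by
  set L := ((r : ℝ) * Real.log 2 + |Real.log ((1 + δ) ^ 2 / δ)|) / Real.log (1 + δ) with hL
  have hL0 : 0 ≤ L := by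
    have h1 : 0 < Real.log (1 + δ) := Real.log_pos (by linarith)
    have h2 : 0 < Real.log 2 := Real.log_pos (by norm_num)
    positivity
  refine ⟨100 * ((1 + L) * (3 + r)), fun n k hn hk G w hr B hB c t hI => ?_⟩
  obtain ⟨H, hC, hP⟩ := hI
  have h1 : (c.2.bits B : ℝ) ≤ 100 * (((n : ℝ) * k + H.length) * (Nat.size n + B + 1)) := by
    exact_mod_cast hP.mem_bits_le B hk (by omega) hC
  obtain ⟨h2, h3⟩ := size_le_logb hn
  have h4 := hC.valid.length_le hδ hn r fun h hh h' hh' => by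
    rw [hC.wt h hh, hC.wt h' hh']
    exact hr _ (hC.mem h hh) _ (hC.mem h' hh')
  rw [← hL] at h4
  set Λ := Real.logb 2 n
  have hnk : (0 : ℝ) ≤ (n : ℝ) * k := by positivity
  -- Both estimates absorb constants by log₂ n ≥ 1. One logarithm comes from the number of pushed
  -- edges, the other from the size of an entry.
  have h5 : (n : ℝ) * k + H.length ≤ n * k * ((1 + L) * Λ) := by nlinarith
  have h6 : (Nat.size n : ℝ) + B + 1 ≤ (3 + r) * Λ := by nlinarith
  calc (c.2.bits B : ℝ) ≤ 100 * (((n : ℝ) * k + H.length) * (Nat.size n + B + 1)) := h1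
    _ ≤ 100 * ((n * k * ((1 + L) * Λ)) * ((3 + r) * Λ)) := by gcongr
    _ = _ := by ring

/-! ### The sizes of the stored numbers -/

/-- A sum of at most n numbers below 2 ^ B needs only `Nat.size n` additional bits, as n < 2 ^
`Nat.size n`. -/
lemma fits_sum {s : ℝ} {B : ℕ} {L : List (Item n)} (hf : ∀ a ∈ L, Fits s B a.wt)
    (hL : L.length ≤ n) : Fits s (B + Nat.size n) (L.map Item.wt).sum := by
  have key : ∃ b : ℕ, b ≤ L.length * 2 ^ B ∧ (L.map Item.wt).sum = b * s := by
    clear hL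
    induction L with
    | nil => exact ⟨0, by simp, by simp⟩
    | cons a L ih =>
      obtain ⟨b, hb, hs⟩ := ih fun a' ha => hf a' (List.mem_cons_of_mem _ ha)
      obtain ⟨b', hb', hs'⟩ := hf a List.mem_cons_self
      refine ⟨b' + b, ?_, ?_⟩
      · rw [List.length_cons, Nat.add_mul]; omega
      · rw [List.map_cons, List.sum_cons, hs, hs']; push_cast; ring
  obtain ⟨b, hb, hs⟩ := key
  refine ⟨b, hb.trans_lt ?_, hs⟩
  rw [pow_add, mul_comm (2 ^ B)]
  exact Nat.mul_lt_mul_of_pos_right (hL.trans_lt (Nat.lt_size_self n)) (by positivity)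

/-- In a proper coloring each vertex has at most one edge of a given color, so the first endpoints
of the edges in a class are distinct. -/
lemma length_colorClass_le {E : List (Sym2 (Fin n))} {D : ℕ} {C : Sym2 (Fin n) → Option ℕ}
    (hC : Proper E D C) {F : List (Item n)} (hF : (F.map Item.edge).Nodup) (c : ℕ) :
    (F.filter fun a => C a.edge = some c).length ≤ n := by
  have hnd : ((F.filter fun a => C a.edge = some c).map Item.u).Nodup := by
    rw [List.Nodup, List.pairwise_map] at hF ⊢
    refine (hF.sublist List.filter_sublist).imp_of_mem fun {a b} ha hb hab hu => ?_
    have ha' : C s(a.u, a.v) = some c := of_decide_eq_true (List.mem_filter.1 ha).2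
    have hb' : C s(b.u, b.v) = some c := of_decide_eq_true (List.mem_filter.1 hb).2
    rw [← hu] at hb'
    have := hC.inj _ _ _ _ ha' hb'
    exact hab (by rw [Item.edge, Item.edge, hu, this])
  simpa using hnd.length_le_card

lemma Inv.numbersFit {c : Config n k} (hδ : 0 < δ) {s : ℝ} {B : ℕ} (hs : 0 < s)
    (hf : ∀ e ∈ G.edgeSet, Fits s B (w e)) (hI : Inv G w δ c t) : c.2.NumbersFit s B := by
  obtain ⟨l, m⟩ := c
  obtain ⟨H, hC, hP⟩ := hI
  dsimp only at hC hP ⊢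
  have hS := hP.small hC
  have hH : ∀ h ∈ H, Fits s B h.a.wt := fun h hh => by
    rw [hC.wt h hh]; exact hf _ (hC.mem h hh)
  have hF : ∀ a ∈ m.F, Fits s B a.wt := fun a ha => by
    obtain ⟨h, hh, rfl⟩ := hS.sub a ha
    exact hH h hh
  refine ⟨fun v i => ?_, fun a ha => ?_, hF, ?_⟩
  · rw [hC.phi]; exact hC.valid.fits_level hδ hs hH v i
  · obtain ⟨h, hh, rfl⟩ := hS.stack a ha
    exact hH h hh
  · cases hp : m.phase <;> simp only [hp] at hP <;> simp only [Phase.NumbersFit]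
    case chase =>
      obtain ⟨-, H₁, f, H₂, Fr, flag₀, R, rfl, rfl, -⟩ := hP
      exact hH f (by simp)
    case select l σ =>
      obtain ⟨-, hT, hPr, -, -, ⟨F₁, hF', hσ⟩, -⟩ := hP
      refine ⟨fun a ha => hF a (by simp [hF', ha]), fun c => ?_⟩
      rw [hσ]
      refine fits_sum (fun a ha => hF a ?_) (length_colorClass_le hPr ?_ c)
      · rw [hF']; exact List.mem_append_left _ (List.mem_filter.1 ha).1
      · have := hT.nodup
        rw [hF', List.map_append] at this
        exact (List.nodup_append.1 this).1

end
end KDM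

theorem mainTheorem4 (ε : ℝ) (hε : 0 < ε) :
    -- every run halts, and outputs an approximate `k`-disjoint matching
    (∀ (n k : ℕ), 1 ≤ k → ∀ (G : SimpleGraph (Fin n)) (w : Sym2 (Fin n) → ℝ),
      (∀ e ∈ G.edgeSet, 0 < w e) → ∀ l : List (KDM.Item n), KDM.IsStream G w l →
        KDM.AlwaysHalts k ε l ∧
        ∀ c : KDM.Config n k, KDM.Reaches ε l c → c.2.phase = KDM.Phase.halt →
          KDM.IsApprox (1 / (2 + ε) * (1 - 1 / ((k : ℝ) + 1))) G w c.2.output) ∧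
    -- space, for weights with polynomially bounded ratio and numbers of `O(log n)` bits
    (∀ r : ℕ, ∃ K : ℝ, ∀ (n k : ℕ), 2 ≤ n → 1 ≤ k →
      ∀ (G : SimpleGraph (Fin n)) (w : Sym2 (Fin n) → ℝ),
      (∀ e ∈ G.edgeSet, 0 < w e) →
      (∀ e ∈ G.edgeSet, ∀ f ∈ G.edgeSet, w e ≤ (n : ℝ) ^ r * w f) →
      ∀ B : ℕ, (B : ℝ) ≤ r * Real.logb 2 n →
      ∀ l : List (KDM.Item n), KDM.IsStream G w l →
      ∀ c : KDM.Config n k, KDM.Reaches ε l c →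
        (c.2.bits B : ℝ) ≤ K * (n * k * Real.logb 2 n ^ 2)) ∧
    -- if the weights are numbers of `B` bits, then so are all numbers that are ever stored
    (∀ (n k : ℕ), 1 ≤ k → ∀ (G : SimpleGraph (Fin n)) (w : Sym2 (Fin n) → ℝ),
      (∀ e ∈ G.edgeSet, 0 < w e) →
      ∀ (B : ℕ) (s : ℝ), 0 < s → (∀ e ∈ G.edgeSet, KDM.Fits s B (w e)) →
      ∀ l : List (KDM.Item n), KDM.IsStream G w l →
      ∀ c : KDM.Config n k, KDM.Reaches ε l c → c.2.NumbersFit s B) := by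
  -- The streaming parameter is ε/2 and the threshold halves it again. The ratio obtained has 2(1 +
  -- ε/4) = 2 + ε/2 in the denominator, slightly better than the required 2 + ε.
  have hδ : 0 < ε / 4 := by positivity
  have hε' : ε / 2 = 2 * (ε / 4) := by ring
  refine ⟨fun n k hk G w hw l hl => ⟨KDM.alwaysHalts hδ hε' hk hw hl, fun c hc hh => ?_⟩,
    fun r => ?_, fun n k hk G w hw B s hs hf l hl c hc => ?_⟩
  · obtain ⟨t, ht⟩ := hc.inv hδ hε' hw hl
    refine (ht.isApprox hδ hk hh).mono ?_ hw
    have hk0 : (0 : ℝ) < (k : ℝ) + 1 := by positivity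
    have h7 : (0 : ℝ) ≤ 1 - 1 / ((k : ℝ) + 1) := by
      rw [sub_nonneg, div_le_one hk0]
      have : (0 : ℝ) ≤ k := by positivity
      linarith
    have h8 : 1 / (2 + ε) ≤ 1 / (2 * (1 + ε / 4)) :=
      one_div_le_one_div_of_le (by positivity) (by linarith)
    gcongr
  · obtain ⟨K, hK⟩ := KDM.exists_space_bound hδ r
    refine ⟨K, fun n k hn hk G w hw hr B hB l hl c hc => ?_⟩
    obtain ⟨t, ht⟩ := hc.inv hδ hε' hw hl
    exact hK n k hn hk G w hr B hB c t ht
  · obtain ⟨t, ht⟩ := hc.inv hδ hε' hw hl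
    exact ht.numbersFit hδ hs hf
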